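/- **Setting.** Let $\mathcal A$ be a set of automorphic objects, closed under an involution $f\mapsto\bar f$. Each $f$ has an $L$-function $L(s,f)=\sum_{n\ge1}\lambda_f(n)n^{-s}$, absolutely convergent in some half-plane, with an entire continuation, and a completed $L$-function $\Lambda(s,f)=L_\infty(s,f)L(s,f)$, where $L_\infty(s,f)=N_f^{s/2}\prod_{\kappa}\pi^{-(s+\kappa)/2}\Gamma\big(\tfrac{s+\kappa}2\big)$ is a finite product over the archimedean parameters $\kappa$ of $f$, $N_f\ge1$ is an integer, and $L_\infty(s,f)$ has no zeros or poles on $\mathrm{Re}(s)=\tfrac12$. It satisfies $\Lambda(s,f)=\varepsilon_f\,\Lambda(1-s,\bar f)$ with $|\varepsilon_f|=1$; here $\lambda_{\bar f}(n)=\overline{\lambda_f(n)}$, $N_{\bar f}=N_f$, and the parameters of $\bar f$ are the conjugates of those of $f$. The non-trivial zeros of $L(s,f)$ are the zeros $\rho_f=\tfrac12+i\gamma_f$ of $\Lambda(s,f)$. Let $c_f>1$, with $c_{\bar f}=c_f$, be the analytic conductor, in any normalization comparable to $N_f\prod_\kappa(|\kappa|+3)$ uniformly in $f$. A family $\mathcal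 F$ is a collection of finite sets of objects $f$, each closed under $f\mapsto\bar f$, with $\#\mathcal F\to\infty$ along some limiting process (a filter); limits and limsups "as $\#\mathcal F\to\infty$" are along it. For $G\in\{\mathrm{U},\mathrm{Sp},\mathrm{O},\mathrm{SO(even)},\mathrm{SO(odd)}\}$ let $$W_{\mathrm U}(x)=1,\quad W_{\mathrm{Sp}}(x)=1-\tfrac{\sin2\pi x}{2\pi x},\quad W_{\mathrm O}(x)=1+\tfrac12\delta_0(x),\quad W_{\mathrm{SO(even)}}(x)=1+\tfrac{\sin2\pi x}{2\pi x},\quad W_{\mathrm{SO(odd)}}(x)=1-\tfrac{\sin2\pi x}{2\pi x}+\delta_0(x),$$ with $\delta_0$ the Dirac mass at $0$. For $\Delta>0$ let $\mathcal H_{G,\pi\Delta}$ be the space of entire functions $F$ of exponential type $\limsup_{|z|\to\infty}|z|^{-1}\log|F(z)|\le\pi\Delta$ with $\int_{\mathbb R}|F(x)|^2W_G(x)\,dx<\infty$. It has a unique reproducing kernel $K=K_{G,\pi\Delta}:\mathbb C\times\mathbb C\to\mathbb C$: for each $w$, $K(w,\cdot)\in\mathcal H_{G,\pi\Delta}$ and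 $F(w)=\int_{\mathbb R}F(x)\overline{K(w,x)}\,W_G(x)\,dx$ for all $F\in\mathcal H_{G,\pi\Delta}$. **Theorem.** Let $\{L(s,f),\ f\in\mathcal F\}$ be such a family, let $G$ be one of the five groups and let $\Delta>0$. Assume GRH for the $L$-functions of the family (all $\gamma_f$ are real), and that for every even Schwartz function $\phi:\mathbb R\to\mathbb R$ with $\mathrm{supp}(\widehat\phi)\subset(-\Delta,\Delta)$, where $\widehat\phi(y)=\int_{\mathbb R}e^{-2\pi ixy}\phi(x)\,dx$, the sums over zeros below converge absolutely and $$\lim_{\#\mathcal F\to\infty}\frac1{\#\mathcal F}\sum_{f\in\mathcal F}\sum_{\gamma_f}\phi\Big(\gamma_f\frac{\log c_f}{2\pi}\Big)=\int_{\mathbb R}\phi(x)\,W_G(x)\,dx ,$$ zeros being counted with multiplicity. Then, with $K=K_{G,\pi\Delta}$: (i) $\displaystyle\limsup_{\#\mathcal F\to\infty}\frac1{\#\mathcal F}\sum_{f\in\mathcal F}\operatorname*{ord}_{s=1/2}L(s,f)\le\frac1{K(0,0)}$. (ii) For every $t>0$, $\displaystyle\limsup_{\#\mathcal F\to\infty}\frac1{\#\mathcal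 F}\sum_{f\in\mathcal F}\operatorname*{ord}_{s=1/2}L\Big(s+\frac{2\pi it}{\log c_f},f\Big)\le\frac1{K(t,t)+|K(t,-t)|}$. -/

import Mathlib

open Filter Topology MeasureTheory Set
open scoped ENNReal ComplexConjugate SchwartzMap FourierTransform

noncomputable section

/-! ### L-functions and families of L-functions -/

/-- The analytic data of an `L`-function (without poles): Dirichlet coefficients `λ(n)`, the entire
function `L(s)` that continues the Dirichlet series `∑ λ(n) n⁻ˢ`, and the data `N`, `κ` of its
archimedean factor `L_∞(s) = N^{s/2} ∏_κ Γ_ℝ(s + κ)`, where `Γ_ℝ(s) = π^{-s/2} Γ(s/2)`. -/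
structure LFunctionData where
  /-- the Dirichlet coefficients `λ(n)`, `n ≥ 1` -/
  coeff : ℕ → ℂ
  /-- the entire function `L(s)` -/
  L : ℂ → ℂ
  /-- the (arithmetic) conductor `N` -/
  cond : ℕ
  /-- the archimedean parameters `κ`, with multiplicity -/
  kappa : Multiset ℂ
  /-- the Dirichlet series converges absolutely in some half-plane -/
  abscissa_lt_top : LSeries.abscissaOfAbsConv coeff < ⊤
  /-- `L(s)` is the sum of its Dirichlet series -/
  L_eq : ∀ s : ℂ, LSeries.abscissaOfAbsConv coeff < (s.re : EReal) → L s = LSeries coeff s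
  entire : Differentiable ℂ L
  cond_pos : 0 < cond
  /-- `L_∞` is regular and non-zero on the critical line. (The gamma function has no zeros, and in
  Mathlib it takes the value `0` at its poles: this single inequality says both.) -/
  regular_on_line : ∀ s : ℂ, s.re = 1 / 2 →
    (cond : ℂ) ^ (s / 2) * (kappa.map fun k => Complex.Gammaℝ (s + k)).prod ≠ 0

namespace LFunctionData

/-- The archimedean factor `L_∞(s)`; in Lean it is `0` exactly at the poles of `L_∞`. -/
def archFactor (D : LFunctionData) (s : ℂ) : ℂ :=
  (D.cond : ℂ) ^ (s / 2) * (D.kappa.map fun k => Complex.Gammaℝ (s + k)).prod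

/-- The completed `L`-function `Λ(s) = L_∞(s) L(s)`, as a meromorphic function (its values at the
poles of `L_∞` are never used). -/
def completed (D : LFunctionData) (s : ℂ) : ℂ := D.archFactor s * D.L s

/-- The multiplicity of `ρ` as a non-trivial zero of `L(s)`, i.e. as a zero of the meromorphic
function `Λ(s)`; it is `0` if `ρ` is not a non-trivial zero. -/
def zeroMult (D : LFunctionData) (ρ : ℂ) : ℕ := (meromorphicOrderAt D.completed ρ).untop₀.toNat

/-- The generalized Riemann hypothesis for `L(s)`: all non-trivial zeros, that is, all zeros of
`Λ(s)`, have real part `1/2`. -/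
def GRH (D : LFunctionData) : Prop :=
  ∀ ρ : ℂ, 0 < meromorphicOrderAt D.completed ρ → ρ.re = 1 / 2

/-- The standard normalization `N ∏_κ (|κ| + 3)` of the analytic conductor. -/
def stdConductor (D : LFunctionData) : ℝ := D.cond * (D.kappa.map fun k => ‖k‖ + 3).prod

/-- `D'` is dual to `D`: conjugate coefficients, the same conductor, conjugate parameters. -/
structure IsDual (D D' : LFunctionData) : Prop where
  coeff_eq : ∀ n : ℕ, n ≠ 0 → D'.coeff n = conj (D.coeff n)
  cond_eq : D'.cond = D.cond
  kappa_eq : D'.kappa = D.kappa.map (starRingEnd ℂ)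

end LFunctionData

/-- A collection `A` of automorphic objects `f` with their `L`-functions, duals `f ↦ f̄`, root
numbers `ε_f` and functional equations `Λ(s, f) = ε_f Λ(1 - s, f̄)`. -/
structure LFamily (A : Type*) where
  data : A → LFunctionData
  dual : A → A
  dual_dual : ∀ f, dual (dual f) = f
  isDual : ∀ f, (data f).IsDual (data (dual f))
  rootNumber : A → ℂ
  norm_rootNumber : ∀ f, ‖rootNumber f‖ = 1
  /-- The functional equation, at every `s` at which no archimedean factor has a pole. -/
  functional_equation : ∀ f (s : ℂ), (data f).archFactor s ≠ 0 →
    (data (dual f)).archFactor (1 - s) ≠ 0 →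
    (data f).completed s = rootNumber f * (data (dual f)).completed (1 - s)

namespace LFamily

variable {A : Type*}

/-- `c_f` is the analytic conductor of `L(s, f)`, in any of the usual normalizations: it is
comparable to `N ∏_κ (|κ| + 3)` uniformly in `f`, takes the same value at `f` and at `f̄`, and is
`> 1`, so that `log c_f > 0`. -/
structure IsAnalyticConductor (𝓛 : LFamily A) (c : A → ℝ) : Prop where
  one_lt : ∀ f, 1 < c f
  dual_eq : ∀ f, c (𝓛.dual f) = c f
  comparable : ∃ B : ℝ, ∀ f,
    c f ≤ B * (𝓛.data f).stdConductor ∧ (𝓛.data f).stdConductor ≤ B * c f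

/-- The contribution of the non-trivial zero `ρ = 1/2 + i γ` to the 1-level density sum of `f`:
`φ(γ log c_f / 2π)` times the multiplicity of `ρ`. -/
def densityTerm (𝓛 : LFamily A) (c : A → ℝ) (φ : ℝ → ℝ) (f : A) (ρ : ℂ) : ℝ :=
  ((𝓛.data f).zeroMult ρ : ℝ) * φ (ρ.im * (Real.log (c f) / (2 * Real.pi)))

/-- The average order of vanishing at `s = 1/2` of `L(s + 2πit / log c_f, f)` over `f ∈ S`. -/
def avgOrder (𝓛 : LFamily A) (c : A → ℝ) (t : ℝ) (S : Finset A) : ℝ≥0∞ :=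
  (∑ f ∈ S, ((analyticOrderAt
      (fun s : ℂ => (𝓛.data f).L (s + 2 * Real.pi * Complex.I * t / Real.log (c f)))
      (1 / 2) : ℕ∞) : ℝ≥0∞)) / (S.card : ℝ≥0∞)

end LFamily

/-! ### Symmetry groups and 1-level densities -/

/-- The five symmetry groups. -/
inductive SymmetryGroup
  | U
  | Sp
  | O
  | SOeven
  | SOodd

/-- The measure `W_G(x) dx`. Here `Real.sinc y = sin y / y` and `δ₀` is a Dirac mass; all
densities are non-negative. -/
def SymmetryGroup.W : SymmetryGroup → Measure ℝ
  | .U => volume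
  | .Sp => volume.withDensity fun x => ENNReal.ofReal (1 - Real.sinc (2 * Real.pi * x))
  | .O => volume + (1 / 2 : ℝ≥0∞) • Measure.dirac 0
  | .SOeven => volume.withDensity fun x => ENNReal.ofReal (1 + Real.sinc (2 * Real.pi * x))
  | .SOodd => (volume.withDensity fun x => ENNReal.ofReal (1 - Real.sinc (2 * Real.pi * x)))
      + Measure.dirac 0

/-- The 1-level density with symmetry group `G` holds for the test function `φ`, along the finite
sets `F i` as `i` tends to infinity along `l`: the sums over zeros converge (absolutely) and their
averages tend to `∫ φ W_G`. -/
def LFamily.OneLevelDensity {A ι : Type*} (𝓛 : LFamily A) (c : A → ℝ) (l : Filter ι)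
    (F : ι → Finset A) (G : SymmetryGroup) (φ : ℝ → ℝ) : Prop :=
  (∀ i, ∀ f ∈ F i, Summable fun ρ : ℂ => 𝓛.densityTerm c φ f ρ) ∧
  Tendsto (fun i => (∑ f ∈ F i, ∑' ρ : ℂ, 𝓛.densityTerm c φ f ρ) / ((F i).card : ℝ)) l
    (𝓝 (∫ x, φ x ∂G.W))

/-! ### The Hilbert spaces and their reproducing kernels -/

/-- The exponential type `τ(F) = limsup_{|z| → ∞} |z|⁻¹ log |F(z)|`. (Lean's `log 0 = 0` at the
zeros of `F` has no influence on whether `τ(F) ≤ τ`, for `τ ≥ 0`.) -/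
def exponentialType (F : ℂ → ℂ) : EReal :=
  limsup (fun z : ℂ => ((‖z‖⁻¹ * Real.log ‖F z‖ : ℝ) : EReal)) (cocompact ℂ)

/-- The space `H_{G, πΔ}` of the entire functions `F` of exponential type at most `πΔ` with
`∫_ℝ |F(x)|² W_G(x) dx < ∞`. -/
def modelSpace (G : SymmetryGroup) (Δ : ℝ) : Set (ℂ → ℂ) :=
  {F | Differentiable ℂ F ∧ exponentialType F ≤ ((Real.pi * Δ : ℝ) : EReal) ∧
    MemLp (fun x : ℝ => F x) 2 G.W}

/-- `K` is a reproducing kernel of `H_{G, πΔ}`: every `K(w, ·)` belongs to the space, and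
`F(w) = ⟨F, K(w, ·)⟩ = ∫ F(x) conj(K(w, x)) W_G(x) dx` for every `F` in the space. -/
def IsReproducingKernel (G : SymmetryGroup) (Δ : ℝ) (K : ℂ → ℂ → ℂ) : Prop :=
  ∀ w : ℂ, K w ∈ modelSpace G Δ ∧
    ∀ F ∈ modelSpace G Δ, F w = ∫ x : ℝ, F x * conj (K w x) ∂G.W

open Classical in
/-- The reproducing kernel `K_{G, πΔ}` (zero if there were none). -/
def reproducingKernel (G : SymmetryGroup) (Δ : ℝ) : ℂ → ℂ → ℂ :=
  if h : ∃ K, IsReproducingKernel G Δ K then h.choose else 0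

end

/-! Take `Φ` in the space H with `|Φ|` even on ℝ. On the real line `|Φ|²` is the restriction of the
entire function Φ(z)·conj Φ(conj z), of type at most 2πΔ, so its Fourier transform lives in [-Δ, Δ]
and `|Φ|²` is essentially an admissible non-negative test function. By positivity, all zeros may be
dropped from the density sum except those at normalized heights t and -t. The functional equation
sends a zero ρ of f to the zero 1 - ρ of its dual, so on average over a self-dual set both heights
carry the same multiplicity. Hence the average order at t is asymptotically at most ∫|Φ|² W_G /
(m|Φ(t)|²), where m = 1 if t = 0 and m = 2 otherwise
(`LFamily.limsup_avgOrder_le_of_mem_modelSpace`).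

Reproducing kernels make this quotient explicit. For t = 0, Φ = K(0,·) gives 1/K(0,0). For t > 0,
K(t,-t) is real; with s = ±1 its sign, Φ = K(t,·) + sK(-t,·) satisfies Φ(t) = M and ∫|Φ|² W_G = 2M,
where M = K(t,t) + |K(t,-t)|, so the quotient is 1/M.

Two points need analysis. First, the kernel exists because the norm of L²(W_G) controls point values
(`SymmetryGroup.exists_norm_le`), although W_G may have density 0 at the origin: H is then closed in
L²(W_G), and Riesz representation applies to evaluation. Second, `|Φ|²` need not be Schwartz, nor
its transform supported in the open interval. It is replaced by |Φ(rx)|²h(εx)² with r < 1 and h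
Schwartz, band-limited, h(0) = 1 and |h| ≤ 1 (`exists_testFunction`); then r tends to 1
(`tendsto_integral_W_comp_mul`). -/

noncomputable section

/-! ### Exponential type: Phragmén–Lindelöf, Plancherel–Pólya, contour shift -/

/-- `G` has exponential type at most `σ`, in the form of explicit bounds. -/
def HasExpType (σ : ℝ) (G : ℂ → ℂ) : Prop :=
  ∀ σ' > σ, ∃ B : ℝ, ∀ z, ‖G z‖ ≤ B * Real.exp (σ' * ‖z‖)

lemma HasExpType.mono {σ τ : ℝ} {G : ℂ → ℂ} (h : HasExpType σ G) (hστ : σ ≤ τ) :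
    HasExpType τ G := fun σ' hσ' => h σ' (hστ.trans_lt hσ')

lemma HasExpType.mul {σ τ : ℝ} {F G : ℂ → ℂ} (hF : HasExpType σ F) (hG : HasExpType τ G) :
    HasExpType (σ + τ) (fun z => F z * G z) := by
  intro s hs
  obtain ⟨A, hA⟩ := hF (σ + (s - (σ + τ)) / 2) (by linarith)
  obtain ⟨B, hB⟩ := hG (τ + (s - (σ + τ)) / 2) (by linarith)
  refine ⟨A * B, fun z => ?_⟩
  rw [norm_mul]
  refine (mul_le_mul (hA z) (hB z) (norm_nonneg _) ((norm_nonneg _).trans (hA z))).trans_eq ?_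
  rw [mul_mul_mul_comm, ← Real.exp_add]
  ring_nf

lemma hasExpType_of_norm_le_exp_im {σ C : ℝ} (hσ : 0 ≤ σ) {G : ℂ → ℂ}
    (h : ∀ z : ℂ, ‖G z‖ ≤ C * Real.exp (σ * |z.im|)) : HasExpType σ G := by
  have hC : 0 ≤ C := by
    have := (norm_nonneg _).trans (h 0)
    simpa using this
  intro σ' hσ'
  have hσ0 : 0 ≤ σ' := hσ.trans hσ'.le
  refine ⟨C, fun z => (h z).trans ?_⟩
  gcongr
  exact Complex.abs_im_le_norm z

/-- After the rotation z = iw, the function G(iw)exp(-σ'w) is bounded on the positive real axis by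
the type and by M on the imaginary axis, so Phragmén–Lindelöf in the right half-plane gives the
bound M there. Then σ' decreases to σ. -/
lemma norm_le_of_upper {σ M : ℝ} {G : ℂ → ℂ} (hd : Differentiable ℂ G)
    (hG : HasExpType σ G) (hM : ∀ x : ℝ, ‖G x‖ ≤ M) {z : ℂ} (hz : 0 ≤ z.im) :
    ‖G z‖ ≤ M * Real.exp (σ * z.im) := by
  have key : ∀ σ' > σ, ‖G z‖ ≤ M * Real.exp (σ' * z.im) := by
    intro σ' hσ'
    obtain ⟨B, hB⟩ := hG σ' hσ'
    have hB0 : 0 ≤ B := by simpa using (norm_nonneg _).trans (hB 0)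
    set f : ℂ → ℂ := fun w => G (Complex.I * w) * Complex.exp (-σ' * w) with hf
    have hnorm : ∀ w, ‖f w‖ = ‖G (Complex.I * w)‖ * Real.exp (-σ' * w.re) := by
      intro w
      simp [hf, Complex.norm_exp]
    have h1 : ‖f (-Complex.I * z)‖ ≤ M := by
      refine PhragmenLindelof.right_half_plane_of_bounded_on_real (f := f) (C := M) ?_ ?_ ?_ ?_ ?_
      · exact Differentiable.diffContOnCl (by fun_prop)
      · refine ⟨1, by norm_num, σ' + |σ'|, ?_⟩
        refine Asymptotics.IsBigO.of_bound B (Eventually.of_forall fun w => ?_)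
        rw [hnorm, Real.norm_eq_abs, Real.abs_exp, Real.rpow_one]
        have e1 := hB (Complex.I * w)
        simp only [norm_mul, Complex.norm_I, one_mul] at e1
        have e2 : Real.exp (-σ' * w.re) ≤ Real.exp (|σ'| * ‖w‖) := by
          refine Real.exp_le_exp.2 ?_
          calc -σ' * w.re ≤ |-σ' * w.re| := le_abs_self _
            _ = |σ'| * |w.re| := by rw [abs_mul, abs_neg]
            _ ≤ _ := by gcongr; exact Complex.abs_re_le_norm w
        refine (mul_le_mul e1 e2 (by positivity) (by positivity)).trans_eq ?_
        rw [mul_assoc, ← Real.exp_add]; ring_nf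
      · refine ⟨B, eventually_map.2 ?_⟩
        filter_upwards [eventually_ge_atTop 0] with x hx
        rw [hnorm]
        have e1 := hB (Complex.I * x)
        simp only [norm_mul, Complex.norm_I, one_mul, Complex.norm_real, Real.norm_eq_abs,
          abs_of_nonneg hx] at e1
        refine (mul_le_mul_of_nonneg_right e1 (by positivity)).trans_eq ?_
        rw [mul_assoc, ← Real.exp_add]; simp
      · intro x
        rw [hnorm]
        have : Complex.I * (x * Complex.I) = ((-x : ℝ) : ℂ) := by
          push_cast; ring_nf; simp
        rw [this]
        simpa using hM (-x)
      · simpa using hz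
    rw [hnorm] at h1
    have e : Complex.I * (-Complex.I * z) = z := by
      rw [← mul_assoc]; simp
    rw [e] at h1
    have e3 : (-Complex.I * z).re = z.im := by simp
    rw [e3] at h1
    calc ‖G z‖ = ‖G z‖ * Real.exp (-σ' * z.im) * Real.exp (σ' * z.im) := by
          rw [mul_assoc, ← Real.exp_add]; simp
      _ ≤ _ := by gcongr
  have : Tendsto (fun s : ℝ => M * Real.exp (s * z.im)) (𝓝[>] σ) (𝓝 (M * Real.exp (σ * z.im))) :=
    Tendsto.mono_left (Continuous.tendsto (by fun_prop) σ) nhdsWithin_le_nhds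
  exact ge_of_tendsto this (by filter_upwards [self_mem_nhdsWithin] with s hs using key s hs)

lemma HasExpType.comp_neg {σ : ℝ} {G : ℂ → ℂ} (h : HasExpType σ G) :
    HasExpType σ (fun z => G (-z)) := fun s hs => by
  obtain ⟨B, hB⟩ := h s hs
  exact ⟨B, fun z => by simpa using hB (-z)⟩

/-- **Phragmén–Lindelöf** for entire functions of exponential type bounded on the real line. -/
lemma HasExpType.norm_le {σ M : ℝ} {G : ℂ → ℂ} (hG : HasExpType σ G) (hd : Differentiable ℂ G)
    (hM : ∀ x : ℝ, ‖G x‖ ≤ M) (z : ℂ) : ‖G z‖ ≤ M * Real.exp (σ * |z.im|) := by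
  rcases le_total 0 z.im with h | h
  · rw [abs_of_nonneg h]; exact norm_le_of_upper hd hG hM h
  · have := norm_le_of_upper (G := fun z => G (-z)) (M := M) (z := -z) (by fun_prop) hG.comp_neg
      (fun x => by simpa using hM (-x)) (by simpa using h)
    rw [abs_of_nonpos h]
    simpa using this

lemma norm_intervalIntegral_le_of_integral_sq_le {f : ℝ → ℂ} (hf : Continuous f)
    (hi : Integrable fun x => ‖f x‖ ^ 2) {N : ℝ} (hN : 0 < N) (hle : ∫ x, ‖f x‖ ^ 2 ≤ N ^ 2)
    (x : ℝ) {u : ℝ} (hu : 0 ≤ u) (hu1 : u ≤ 1) : ‖∫ y in x..(x + u), f y‖ ≤ N := by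
  have hxu : x ≤ x + u := by linarith
  calc ‖∫ y in x..(x + u), f y‖ ≤ ∫ y in x..(x + u), ‖f y‖ :=
        intervalIntegral.norm_integral_le_integral_norm hxu
    -- The inequality |f| ≤ N/2 + |f|²/(2N) stands in for Cauchy–Schwarz.
    _ ≤ ∫ y in x..(x + u), (N / 2 + (2 * N)⁻¹ * ‖f y‖ ^ 2) := by
        refine intervalIntegral.integral_mono_on hxu
          (Continuous.intervalIntegrable (by fun_prop) _ _)
          (Continuous.intervalIntegrable (by fun_prop) _ _) fun y _ => ?_
        have : N / 2 + (2 * N)⁻¹ * ‖f y‖ ^ 2 - ‖f y‖ = (2 * N)⁻¹ * (‖f y‖ - N) ^ 2 := by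
          field_simp; ring
        have h2 : 0 ≤ (2 * N)⁻¹ * (‖f y‖ - N) ^ 2 := by positivity
        linarith
    _ = u * (N / 2) + (2 * N)⁻¹ * ∫ y in x..(x + u), ‖f y‖ ^ 2 := by
        rw [intervalIntegral.integral_add (by simp)
          (Continuous.intervalIntegrable (by fun_prop) _ _)]
        simp [mul_div_assoc]
    _ ≤ 1 * (N / 2) + (2 * N)⁻¹ * N ^ 2 := by
        gcongr
        rw [intervalIntegral.integral_of_le hxu]
        exact (setIntegral_le_integral hi (Eventually.of_forall fun y => by positivity)).trans hle
    _ = N := by field_simp; ring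

/-- A quantitative Plancherel–Pólya bound. -/
lemma HasExpType.norm_le_of_integral_sq_le {τ : ℝ} (hτ : 0 ≤ τ) {F : ℂ → ℂ}
    (hF : HasExpType τ F) (hd : Differentiable ℂ F) (hi : Integrable fun x : ℝ => ‖F x‖ ^ 2)
    {N : ℝ} (hN : 0 < N) (hle : ∫ x : ℝ, ‖F x‖ ^ 2 ≤ N ^ 2) (z : ℂ) :
    ‖F z‖ ≤ (1 + Real.exp τ) * N * Real.exp (τ * |z.im|) := by
  refine hF.norm_le hd (fun x => ?_) z
  obtain ⟨Q, hQ⟩ := hd.isExactOn_univ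
  have hQ' : ∀ z, HasDerivAt Q (F z) z := fun z => hQ z (mem_univ z)
  have hQd : Differentiable ℂ Q := fun z => (hQ' z).differentiableAt
  have hFc : Continuous fun x : ℝ => F x := hd.continuous.comp Complex.continuous_ofReal
  have hreal : ∀ (a : ℝ) (u : ℝ), Q ((a + u : ℝ) : ℂ) - Q (a : ℂ) = ∫ y in a..(a + u), F y := by
    intro a u
    rw [intervalIntegral.integral_eq_sub_of_hasDerivAt (f := fun y : ℝ => Q y)
      (fun y _ => (hQ' y).comp_ofReal) (hFc.intervalIntegrable _ _)]
  -- Increments of a primitive `Q` are bounded on ℝ by the L² norm of F and inherit its type, so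
  -- Phragmén–Lindelöf applies to them before F itself is known to be bounded.
  have hP : ∀ u : ℝ, 0 ≤ u → u ≤ 1 → ∀ w : ℂ, ‖Q (w + u) - Q w‖ ≤ N * Real.exp (τ * |w.im|) := by
    intro u hu hu1
    refine HasExpType.norm_le (G := fun w => Q (w + u) - Q w) ?_ (by fun_prop) ?_
    · intro s hs
      obtain ⟨B, hB⟩ := hF s hs
      have hB0 : 0 ≤ B := by simpa using (norm_nonneg _).trans (hB 0)
      have hs0 : 0 < s := hτ.trans_lt hs
      refine ⟨B * Real.exp s, fun w => ?_⟩
      have := Convex.norm_image_sub_le_of_norm_deriv_le (f := Q) (s := Metric.closedBall w u)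
        (C := B * Real.exp s * Real.exp (s * ‖w‖)) (x := w) (y := w + u)
        (fun v _ => hQd v) (fun v hv => ?_) (convex_closedBall w u)
        (Metric.mem_closedBall_self hu) (by simp [abs_of_nonneg hu])
      · refine this.trans ?_
        have : ‖w + u - w‖ ≤ 1 := by simpa [abs_of_nonneg hu] using hu1
        exact mul_le_of_le_one_right (by positivity) this
      · rw [(hQ' v).deriv, mul_assoc, ← Real.exp_add]
        refine (hB v).trans ?_
        gcongr
        have h1 : ‖v - w‖ ≤ u := by simpa [dist_eq_norm] using hv
        have h2 : ‖v‖ ≤ ‖v - w‖ + ‖w‖ := by simpa using norm_add_le (v - w) w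
        nlinarith
    · intro a
      have := hreal a u
      push_cast at this
      rw [this]
      exact norm_intervalIntegral_le_of_integral_sq_le hFc hi hN hle a hu hu1
  -- Cauchy's estimate on the unit circle about x, for the derivative of w ↦ Q(w + u) - Q(w).
  have hdiff : ∀ u : ℝ, 0 ≤ u → u ≤ 1 → ‖F (x + u) - F x‖ ≤ N * Real.exp τ := by
    intro u hu hu1
    have hder : HasDerivAt (fun w => Q (w + u) - Q w) (F (x + u) - F x) x :=
      ((hQ' (x + u)).comp_add_const (x : ℂ) (u : ℂ)).sub (hQ' x)
    rw [← hder.deriv]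
    have := Complex.norm_deriv_le_of_forall_mem_sphere_norm_le (f := fun w => Q (w + u) - Q w)
      (c := x) (R := 1) (C := N * Real.exp τ) one_pos
      (Differentiable.diffContOnCl (by fun_prop)) (fun w hw => ?_)
    · simpa using this
    · refine (hP u hu hu1 w).trans ?_
      gcongr
      have h1 : ‖w - x‖ = 1 := by simpa [dist_eq_norm] using hw
      have h2 : |w.im| ≤ 1 := by
        rw [← h1]
        simpa using Complex.abs_im_le_norm (w - x)
      nlinarith [abs_nonneg w.im]
  -- F(x) is its mean over [x, x + 1] minus the mean of the differences just bounded.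
  have hsplit : F x = (∫ y in (x:ℝ)..(x + 1), F y) - ∫ u in (0:ℝ)..1, (F (x + u) - F x) := by
    have hFc' := hd.continuous
    rw [intervalIntegral.integral_sub (f := fun u : ℝ => F (x + u))
      (Continuous.intervalIntegrable (by fun_prop) _ _) (by simp)]
    have : ∫ u in (0:ℝ)..1, F (x + u) = ∫ y in (x:ℝ)..(x + 1), F y := by
      have := intervalIntegral.integral_comp_add_left (a := 0) (b := 1) (fun y : ℝ => F y) x
      simpa using this
    rw [this]; simp
  rw [hsplit]
  have h1 := norm_intervalIntegral_le_of_integral_sq_le hFc hi hN hle x zero_le_one le_rfl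
  have h2 : ‖∫ u in (0:ℝ)..1, (F (x + u) - F x)‖ ≤ N * Real.exp τ * |1 - 0| :=
    intervalIntegral.norm_integral_le_of_norm_le_const fun u hu => by
      rw [uIoc_of_le zero_le_one] at hu
      exact hdiff u hu.1.le hu.2
  refine (norm_sub_le _ _).trans ?_
  simp at h2
  linarith

/-- Contour shift to `+i∞`. -/
lemma integral_eq_zero_of_decay_upper {g : ℂ → ℂ} (hd : Differentiable ℂ g) {M a : ℝ} (ha : 0 < a)
    (hg : ∀ z : ℂ, 0 ≤ z.im → ‖g z‖ ≤ M * Real.exp (-a * z.im) / (1 + z.re ^ 2)) :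
    ∫ x : ℝ, g x = 0 := by
  have hM : 0 ≤ M := by
    have := (norm_nonneg _).trans (hg 0 le_rfl)
    simpa using this
  have hc : Continuous g := hd.continuous
  have hint : Integrable fun x : ℝ => g x := by
    refine Integrable.mono' (integrable_inv_one_add_sq.const_mul M)
      (hc.comp Complex.continuous_ofReal).aestronglyMeasurable (Eventually.of_forall fun x => ?_)
    simpa [div_eq_mul_inv] using hg x (by simp)
  -- Cauchy's theorem on [-T, T] × [0, Y]. The vertical sides vanish as T → ∞ with Y fixed; the top
  -- edge then vanishes as Y → ∞.
  have hrect : ∀ T : ℝ, 0 ≤ T → ∀ Y : ℝ, 0 ≤ Y → ‖∫ x in (-T)..T, g x‖ ≤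
      M * Real.exp (-a * Y) * Real.pi + 2 * (M / (1 + T ^ 2) * Y) := by
    intro T hT Y hY
    have h := Complex.integral_boundary_rect_eq_zero_of_differentiableOn g (-T : ℂ)
      (T + Y * Complex.I) hd.differentiableOn
    simp only [Complex.neg_re, Complex.ofReal_re, Complex.neg_im, Complex.ofReal_im, neg_zero,
      Complex.add_re, Complex.mul_re, Complex.I_re, mul_zero, Complex.I_im, mul_one, sub_self,
      add_zero, Complex.add_im, Complex.mul_im, zero_add, Complex.ofReal_zero, zero_mul,
      smul_eq_mul, Complex.ofReal_neg] at h
    have h1 : ‖∫ x in (-T)..T, g (x + Y * Complex.I)‖ ≤ M * Real.exp (-a * Y) * Real.pi := by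
      calc _ ≤ ∫ x in (-T)..T, ‖g (x + Y * Complex.I)‖ :=
            intervalIntegral.norm_integral_le_integral_norm (by linarith)
        _ ≤ ∫ x in (-T)..T, M * Real.exp (-a * Y) * (1 + x ^ 2)⁻¹ := by
            refine intervalIntegral.integral_mono_on (by linarith)
              (Continuous.intervalIntegrable (by fun_prop) _ _)
              (Integrable.intervalIntegrable (integrable_inv_one_add_sq.const_mul _)) fun x _ => ?_
            simpa [div_eq_mul_inv] using hg (x + Y * Complex.I) (by simpa using hY)
        _ ≤ ∫ x : ℝ, M * Real.exp (-a * Y) * (1 + x ^ 2)⁻¹ := by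
            rw [intervalIntegral.integral_of_le (by linarith)]
            exact setIntegral_le_integral (integrable_inv_one_add_sq.const_mul _)
              (Eventually.of_forall fun x => by positivity)
        _ = _ := by rw [integral_const_mul, integral_univ_inv_one_add_sq]
    have hside : ∀ s : ℝ, s ^ 2 = T ^ 2 → ‖∫ y in (0:ℝ)..Y, g (s + y * Complex.I)‖ ≤
        M / (1 + T ^ 2) * Y := by
      intro s hs
      have := intervalIntegral.norm_integral_le_of_norm_le_const (a := 0) (b := Y)
        (C := M / (1 + T ^ 2)) (f := fun y : ℝ => g (s + y * Complex.I)) fun y hy => ?_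
      · simpa [abs_of_nonneg hY] using this
      · rw [uIoc_of_le hY] at hy
        refine (hg _ (by simpa using hy.1.le)).trans ?_
        simp only [Complex.add_re, Complex.ofReal_re, Complex.mul_re, Complex.I_re, mul_zero,
          Complex.ofReal_im, Complex.I_im, mul_one, sub_self, add_zero, Complex.add_im,
          Complex.mul_im, zero_add, hs]
        gcongr
        refine mul_le_of_le_one_right hM (Real.exp_le_one_iff.2 ?_)
        nlinarith [hy.1]
    have h2 := hside T rfl
    have h3 := hside (-T) (by ring)
    push_cast at h3
    have : ∫ x in (-T)..T, g x = (∫ x in (-T)..T, g (x + Y * Complex.I))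
        - Complex.I * (∫ y in (0:ℝ)..Y, g (T + y * Complex.I))
        + Complex.I * (∫ y in (0:ℝ)..Y, g (-T + y * Complex.I)) := by
      linear_combination h
    rw [this]
    refine (norm_add_le _ _).trans ((add_le_add_left (norm_sub_le _ _) _).trans ?_)
    rw [norm_mul, norm_mul, Complex.norm_I]
    linarith
  have hY : ∀ Y : ℝ, 0 ≤ Y → ‖∫ x : ℝ, g x‖ ≤ M * Real.exp (-a * Y) * Real.pi := by
    intro Y hY
    have h1 : Tendsto (fun T : ℝ => ‖∫ x in (-T)..T, g x‖) atTop (𝓝 ‖∫ x : ℝ, g x‖) :=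
      (intervalIntegral_tendsto_integral hint tendsto_neg_atTop_atBot tendsto_id).norm
    have h2 : Tendsto (fun T : ℝ => M * Real.exp (-a * Y) * Real.pi + 2 * (M / (1 + T ^ 2) * Y))
        atTop (𝓝 (M * Real.exp (-a * Y) * Real.pi + 2 * (0 * Y))) := by
      refine tendsto_const_nhds.add (((Tendsto.div_atTop tendsto_const_nhds ?_).mul_const _).const_mul _)
      exact tendsto_atTop_add_const_left _ _ (tendsto_pow_atTop two_ne_zero)
    have := le_of_tendsto_of_tendsto h1 h2
      (by filter_upwards [eventually_ge_atTop 0] with T hT using hrect T hT Y hY)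
    simpa using this
  have h3 : Tendsto (fun Y : ℝ => M * Real.exp (-a * Y) * Real.pi) atTop
      (𝓝 (M * 0 * Real.pi)) := by
    refine (Tendsto.const_mul _ (Real.tendsto_exp_atBot.comp ?_)).mul_const _
    exact tendsto_id.const_mul_atTop_of_neg (by linarith)
  have := ge_of_tendsto h3 (by filter_upwards [eventually_ge_atTop 0] with Y h using hY Y h)
  exact norm_le_zero_iff.1 (by simpa using this)

/-! ### The measures W_G and pointwise bounds from the L²(W_G) norm -/

lemma exists_abs_sinc_le {η : ℝ} (hη : 0 < η) : ∃ m < 1, ∀ y : ℝ, η ≤ |y| → |Real.sinc y| ≤ m := by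
  have hlt : ∀ y : ℝ, y ≠ 0 → |Real.sinc y| < 1 := by
    intro y hy
    rw [Real.sinc_of_ne_zero hy, abs_div, div_lt_one (abs_pos.2 hy)]
    exact Real.abs_sin_lt_abs hy
  -- Compactness covers η ≤ |y| ≤ max η 2; beyond that, |sinc y| ≤ 1/|y| ≤ 1/2.
  obtain ⟨y₀, hy₀, hmax⟩ := (isCompact_Icc (a := η) (b := max η 2)).exists_isMaxOn
    ⟨η, by simp⟩ (f := fun y => |Real.sinc y|) (Real.continuous_sinc.abs.continuousOn)
  have hy₀0 : y₀ ≠ 0 := (hη.trans_le hy₀.1).ne'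
  refine ⟨max |Real.sinc y₀| (1 / 2), max_lt (hlt y₀ hy₀0) (by norm_num), fun y hy => ?_⟩
  have habs : |Real.sinc y| = |Real.sinc (|y|)| := by
    rcases abs_choice y with h | h <;> rw [h]
    rw [Real.sinc_neg]
  rw [habs]
  rcases le_total |y| (max η 2) with h | h
  · exact le_max_of_le_left (hmax ⟨hy, h⟩)
  · refine le_max_of_le_right ?_
    have h2 : 2 ≤ |y| := (le_max_right _ _).trans h
    have h0 : |y| ≠ 0 := by positivity
    rw [Real.sinc_of_ne_zero h0, abs_div, abs_abs]
    have := Real.abs_sin_le_one |y|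
    rw [div_le_div_iff₀ (by positivity) (by norm_num)]
    linarith

namespace SymmetryGroup

/-- The density of the absolutely continuous part of `W_G`. -/
def density : SymmetryGroup → ℝ → ℝ
  | .U => fun _ => 1
  | .Sp => fun x => 1 - Real.sinc (2 * Real.pi * x)
  | .O => fun _ => 1
  | .SOeven => fun x => 1 + Real.sinc (2 * Real.pi * x)
  | .SOodd => fun x => 1 - Real.sinc (2 * Real.pi * x)

/-- The mass of `W_G` at the origin. -/
def atom : SymmetryGroup → ℝ
  | .U => 0
  | .Sp => 0
  | .O => 1 / 2
  | .SOeven => 0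
  | .SOodd => 1

variable (G : SymmetryGroup)

lemma atom_nonneg : 0 ≤ G.atom := by cases G <;> simp [atom]

/-- Lets the five cases be treated together: from here on, only a continuous even density with
values in [0, 2], bounded below away from 0, and an atom at 0 matter. -/
lemma W_eq : G.W = volume.withDensity (fun x => ENNReal.ofReal (G.density x)) +
    ENNReal.ofReal G.atom • Measure.dirac 0 := by
  have : ENNReal.ofReal 2⁻¹ = 2⁻¹ := by
    rw [ENNReal.ofReal_inv_of_pos two_pos]; simp
  cases G <;> simp [W, density, atom, this]

lemma continuous_density : Continuous G.density := by
  have := Real.continuous_sinc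
  cases G <;> unfold density <;> fun_prop

lemma density_neg (x : ℝ) : G.density (-x) = G.density x := by
  have : Real.sinc (-(2 * Real.pi * x)) = Real.sinc (2 * Real.pi * x) := Real.sinc_neg _
  cases G <;> simp [density, this]

lemma density_nonneg (x : ℝ) : 0 ≤ G.density x := by
  have h1 := Real.sinc_le_one (2 * Real.pi * x)
  have h2 := Real.neg_one_le_sinc (2 * Real.pi * x)
  cases G <;> simp only [density] <;> linarith

lemma density_le_two (x : ℝ) : G.density x ≤ 2 := by
  have h1 := Real.sinc_le_one (2 * Real.pi * x)
  have h2 := Real.neg_one_le_sinc (2 * Real.pi * x)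
  cases G <;> simp only [density] <;> linarith

lemma exists_le_density {δ : ℝ} (hδ : 0 < δ) : ∃ c > 0, ∀ x, δ ≤ |x| → c ≤ G.density x := by
  obtain ⟨m, hm, h⟩ := exists_abs_sinc_le (η := 2 * Real.pi * δ) (by positivity)
  have h' : ∀ x, δ ≤ |x| → |Real.sinc (2 * Real.pi * x)| ≤ m := fun x hx => h _ (by
    rw [abs_mul, abs_of_pos (show (0:ℝ) < 2 * Real.pi by positivity)]
    gcongr)
  have hm0 : 0 ≤ m := (abs_nonneg _).trans (h' δ (le_abs_self _))
  refine ⟨1 - m, by linarith, fun x hx => ?_⟩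
  have := abs_le.1 (h' x hx)
  cases G <;> simp only [density] <;> linarith

variable {G} {E : Type*} [NormedAddCommGroup E] [NormedSpace ℝ E]

lemma integrable_W_iff {g : ℝ → E} :
    Integrable g G.W ↔ Integrable fun x => G.density x • g x := by
  have h1 : Integrable g (ENNReal.ofReal G.atom • Measure.dirac 0) :=
    (integrable_dirac (by simp)).smul_measure (by simp)
  rw [W_eq, integrable_add_measure, and_iff_left h1,
    integrable_withDensity_iff_integrable_smul' (by
      have := G.continuous_density.measurable; fun_prop) (by simp)]
  simp [ENNReal.toReal_ofReal (G.density_nonneg _)]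

lemma integral_W [CompleteSpace E] {g : ℝ → E} (hi : Integrable g G.W) :
    ∫ x, g x ∂G.W = (∫ x, G.density x • g x) + G.atom • g 0 := by
  have hi' := hi
  rw [W_eq, integrable_add_measure] at hi'
  rw [W_eq, integral_add_measure hi'.1 hi'.2, integral_smul_measure, integral_dirac,
    ENNReal.toReal_ofReal G.atom_nonneg,
    integral_withDensity_eq_integral_toReal_smul (by
      have := G.continuous_density.measurable; fun_prop) (by simp)]
  simp [ENNReal.toReal_ofReal (G.density_nonneg _)]

lemma integrable_W_of_volume {g : ℝ → E} (hg : Continuous g) (hi : Integrable g) :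
    Integrable g G.W := by
  rw [integrable_W_iff]
  refine Integrable.mono' (hi.norm.const_mul 2)
    (G.continuous_density.smul hg).aestronglyMeasurable (Eventually.of_forall fun x => ?_)
  rw [norm_smul, Real.norm_eq_abs, abs_of_nonneg (G.density_nonneg x)]
  gcongr
  exact G.density_le_two x

/-- The density is bounded below for |x| ≥ 1, and on [-1, 1], where it may vanish, continuity of g
suffices. -/
lemma integrable_volume_of_W {g : ℝ → E} (hg : Continuous g) (hi : Integrable g G.W) :
    Integrable g := by
  rw [integrable_W_iff] at hi
  obtain ⟨c, hc, h⟩ := G.exists_le_density one_pos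
  refine Integrable.mono' (g := fun x => c⁻¹ * ‖G.density x • g x‖ + (Icc (-1) 1).indicator (fun x => ‖g x‖) x) ?_
    hg.aestronglyMeasurable (Eventually.of_forall fun x => ?_)
  · refine (hi.norm.const_mul _).add ?_
    rw [integrable_indicator_iff measurableSet_Icc]
    exact hg.norm.continuousOn.integrableOn_Icc
  · by_cases hx : x ∈ Icc (-1) 1
    · rw [indicator_of_mem hx]
      simp; positivity
    · rw [indicator_of_notMem hx, add_zero, norm_smul, Real.norm_eq_abs,
        abs_of_nonneg (G.density_nonneg x)]
      have hx1 : 1 ≤ |x| := by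
        by_contra hlt
        exact hx (abs_le.1 (not_le.1 hlt).le)
      have := h x hx1
      rw [← mul_assoc]
      refine le_mul_of_one_le_left (norm_nonneg _) ?_
      rw [inv_mul_eq_div, one_le_div hc]
      exact this

lemma integrable_W_iff_volume {g : ℝ → E} (hg : Continuous g) :
    Integrable g G.W ↔ Integrable g :=
  ⟨integrable_volume_of_W hg, integrable_W_of_volume hg⟩

/-- On spaces of entire functions of given exponential type, the norm of `L²(W_G)` controls the
values. -/
lemma exists_norm_le (G : SymmetryGroup) {τ : ℝ} (hτ : 0 ≤ τ) : ∃ C > 0, ∀ F : ℂ → ℂ,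
    Differentiable ℂ F → HasExpType τ F → (Integrable fun x : ℝ => ‖F x‖ ^ 2) →
    ∀ N > 0, ∫ x : ℝ, ‖F x‖ ^ 2 ∂G.W ≤ N ^ 2 → ∀ z, ‖F z‖ ≤ C * N * Real.exp (τ * |z.im|) := by
  set C₀ := 1 + Real.exp τ with hC₀
  have hC₀pos : 0 < C₀ := by positivity
  -- Chosen so that 2δC₀² = 1/2. By Plancherel–Pólya, [-δ, δ] contributes at most half of ∫|F|²,
  -- which can be absorbed; outside it the density is at least `c`. The excision is forced by Sp and
  -- SO(odd), whose densities vanish at 0.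
  set δ := 1 / (4 * C₀ ^ 2) with hδ
  have hδpos : 0 < δ := by positivity
  obtain ⟨c, hc, hcd⟩ := G.exists_le_density hδpos
  refine ⟨C₀ * √(2 / c), by positivity, fun F hd hF hi N hN hle z => ?_⟩
  have hFc' := hd.continuous
  have hFc : Continuous fun x : ℝ => F x := hd.continuous.comp Complex.continuous_ofReal
  have hiW : Integrable (fun x : ℝ => ‖F x‖ ^ 2) G.W := integrable_W_of_volume (by fun_prop) hi
  have hJ : ∫ x : ℝ, G.density x * ‖F x‖ ^ 2 ≤ N ^ 2 := by
    rw [integral_W hiW] at hle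
    have := G.atom_nonneg
    have : 0 ≤ G.atom • ‖F (0 : ℝ)‖ ^ 2 := by positivity
    simp only [smul_eq_mul] at hle this ⊢
    linarith
  have hdi : Integrable fun x : ℝ => G.density x * ‖F x‖ ^ 2 :=
    integrable_W_iff.1 hiW
  set I := ∫ x : ℝ, ‖F x‖ ^ 2 with hI
  have hI0 : 0 ≤ I := integral_nonneg fun x => by positivity
  have hbound : I ≤ 2 / c * N ^ 2 := by
    rcases hI0.eq_or_lt with h0 | h0
    · rw [← h0]; positivity
    have hpt := hF.norm_le_of_integral_sq_le hτ hd hi (Real.sqrt_pos.2 h0) (Real.sq_sqrt hI0).ge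
    have hx : ∀ x : ℝ, ‖F x‖ ^ 2 ≤ C₀ ^ 2 * I := fun x => by
      have := hpt x
      simp only [Complex.ofReal_im, abs_zero, mul_zero, Real.exp_zero, mul_one] at this
      calc ‖F x‖ ^ 2 ≤ (C₀ * √I) ^ 2 := by gcongr
        _ = _ := by rw [mul_pow, Real.sq_sqrt hI0]
    have h1 : I ≤ ∫ x : ℝ, ((Icc (-δ) δ).indicator (fun _ => C₀ ^ 2 * I) x
        + c⁻¹ * (G.density x * ‖F x‖ ^ 2)) := by
      refine integral_mono hi (Integrable.add ?_ (hdi.const_mul _)) fun x => ?_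
      · rw [integrable_indicator_iff measurableSet_Icc]
        exact continuousOn_const.integrableOn_Icc
      · have hnn : 0 ≤ c⁻¹ * (G.density x * ‖F x‖ ^ 2) := by
          have := G.density_nonneg x; positivity
        by_cases h : x ∈ Icc (-δ) δ
        · simp only [indicator_of_mem h]
          linarith [hx x]
        · simp only [indicator_of_notMem h, zero_add]
          have hx1 : δ ≤ |x| := by
            by_contra hlt
            exact h (abs_le.1 (not_le.1 hlt).le)
          rw [← mul_assoc]
          refine le_mul_of_one_le_left (by positivity) ?_
          rw [inv_mul_eq_div, one_le_div hc]
          exact hcd x hx1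
    rw [integral_add (by
        rw [integrable_indicator_iff measurableSet_Icc]
        exact continuousOn_const.integrableOn_Icc) (hdi.const_mul _),
      integral_indicator measurableSet_Icc, setIntegral_const, integral_const_mul] at h1
    have h2 : volume.real (Icc (-δ) δ) • (C₀ ^ 2 * I) = I / 2 := by
      rw [Real.volume_real_Icc_of_le (by linarith), smul_eq_mul, hδ]
      field_simp; ring
    have h3 : c⁻¹ * ∫ x : ℝ, G.density x * ‖F x‖ ^ 2 ≤ c⁻¹ * N ^ 2 := by gcongr
    rw [h2] at h1
    rw [div_mul_eq_mul_div, mul_div_assoc, div_eq_inv_mul (N ^ 2)]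
    linarith
  have hN' : I ≤ (√(2 / c) * N) ^ 2 := by
    rw [mul_pow, Real.sq_sqrt (by positivity)]; exact hbound
  have := hF.norm_le_of_integral_sq_le hτ hd hi (N := √(2 / c) * N) (by positivity) hN' z
  rw [← mul_assoc] at this
  exact this

end SymmetryGroup

/-! ### The limsup definition of type, and the model space in terms of Lebesgue measure -/

lemma HasExpType.of_exponentialType_le {σ : ℝ} (hσ : 0 ≤ σ) {F : ℂ → ℂ} (hF : Continuous F)
    (h : exponentialType F ≤ (σ : EReal)) : HasExpType σ F := by
  intro s hs
  have hs0 : 0 < s := hσ.trans_lt hs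
  have hev : ∀ᶠ z in cocompact ℂ, ((‖z‖⁻¹ * Real.log ‖F z‖ : ℝ) : EReal) < (s : EReal) :=
    eventually_lt_of_limsup_lt (h.trans_lt (EReal.coe_lt_coe_iff.2 hs))
  obtain ⟨K, hK, hKs⟩ := mem_cocompact.1 hev
  obtain ⟨C, hC⟩ := (hK.insert 0).exists_bound_of_continuousOn hF.continuousOn
  refine ⟨max C 1, fun z => ?_⟩
  by_cases hz : z ∈ insert 0 K
  · calc ‖F z‖ ≤ C := hC z hz
      _ ≤ max C 1 := le_max_left _ _
      _ ≤ _ := le_mul_of_one_le_right (by positivity) (Real.one_le_exp (by positivity))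
  · have hlt : ‖z‖⁻¹ * Real.log ‖F z‖ < s := EReal.coe_lt_coe_iff.1 (hKs fun h => hz (Or.inr h))
    refine le_trans ?_ (le_mul_of_one_le_left (by positivity) (le_max_right C 1))
    rcases eq_or_ne (F z) 0 with h0 | h0
    · rw [h0, norm_zero]; positivity
    rw [← Real.log_le_iff_le_exp (norm_pos_iff.2 h0)]
    have : 0 < ‖z‖ := norm_pos_iff.2 fun h => hz (Or.inl h)
    rw [inv_mul_lt_iff₀ this] at hlt
    linarith

lemma HasExpType.exponentialType_le {σ : ℝ} (hσ : 0 ≤ σ) {F : ℂ → ℂ} (h : HasExpType σ F) :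
    exponentialType F ≤ (σ : EReal) := by
  have key : ∀ s : ℝ, σ < s → exponentialType F ≤ (s : EReal) := by
    intro s hs
    obtain ⟨B, hB⟩ := h ((σ + s) / 2) (by linarith)
    refine limsup_le_of_le (by isBoundedDefault) ?_
    have hlarge : ∀ᶠ z in cocompact ℂ, Real.log (max B 1) / ((s - σ) / 2) + 1 ≤ ‖z‖ :=
      (tendsto_norm_cocompact_atTop (E := ℂ)).eventually_ge_atTop _
    have hL : 0 ≤ Real.log (max B 1) := Real.log_nonneg (le_max_right _ _)
    filter_upwards [hlarge] with z hz
    have hs2 : 0 < (s - σ) / 2 := by linarith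
    have hz0 : 0 < ‖z‖ := by
      have : 0 ≤ Real.log (max B 1) / ((s - σ) / 2) := by positivity
      linarith
    rw [EReal.coe_le_coe_iff, inv_mul_le_iff₀ hz0]
    have h1 : Real.log (max B 1) ≤ (s - σ) / 2 * ‖z‖ := by
      have : Real.log (max B 1) / ((s - σ) / 2) ≤ ‖z‖ := by linarith
      rwa [div_le_iff₀' hs2] at this
    have h2 : Real.log ‖F z‖ ≤ Real.log (max B 1) + (σ + s) / 2 * ‖z‖ := by
      -- At a zero of F the convention log 0 = 0 is harmless because σ ≥ 0.
      rcases eq_or_ne (F z) 0 with h0 | h0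
      · rw [h0, norm_zero, Real.log_zero]
        have : 0 ≤ (σ + s) / 2 * ‖z‖ := mul_nonneg (by linarith) hz0.le
        linarith
      · have hm : (0:ℝ) < max B 1 := by positivity
        rw [Real.log_le_iff_le_exp (norm_pos_iff.2 h0), Real.exp_add, Real.exp_log hm]
        refine (hB z).trans ?_
        gcongr
        exact le_max_left _ _
    nlinarith
  refine le_of_forall_gt_imp_ge_of_dense fun a ha => ?_
  obtain ⟨s, hs1, hs2⟩ := EReal.lt_iff_exists_real_btwn.1 ha
  exact (key s (EReal.coe_lt_coe_iff.1 hs1)).trans hs2.le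

lemma mem_modelSpace_iff {G : SymmetryGroup} {Δ : ℝ} (hΔ : 0 < Δ) {F : ℂ → ℂ} :
    F ∈ modelSpace G Δ ↔ Differentiable ℂ F ∧ HasExpType (Real.pi * Δ) F ∧
      Integrable fun x : ℝ => ‖F x‖ ^ 2 := by
  have hτ : 0 ≤ Real.pi * Δ := by positivity
  refine and_congr_right fun hd => and_congr
    ⟨HasExpType.of_exponentialType_le hτ hd.continuous, HasExpType.exponentialType_le hτ⟩ ?_
  have hFc' := hd.continuous
  have hFc : Continuous fun x : ℝ => F x := hd.continuous.comp Complex.continuous_ofReal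
  rw [memLp_two_iff_integrable_sq_norm hFc.aestronglyMeasurable,
    SymmetryGroup.integrable_W_iff_volume (by fun_prop)]

lemma HasExpType.add {σ : ℝ} {F G : ℂ → ℂ} (hF : HasExpType σ F) (hG : HasExpType σ G) :
    HasExpType σ (fun z => F z + G z) := by
  intro s hs
  obtain ⟨A, hA⟩ := hF s hs
  obtain ⟨B, hB⟩ := hG s hs
  refine ⟨A + B, fun z => (norm_add_le _ _).trans ?_⟩
  rw [add_mul]
  exact add_le_add (hA z) (hB z)

lemma HasExpType.const_mul {σ : ℝ} {F : ℂ → ℂ} (hF : HasExpType σ F) (a : ℂ) :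
    HasExpType σ (fun z => a * F z) := by
  intro s hs
  obtain ⟨A, hA⟩ := hF s hs
  refine ⟨‖a‖ * A, fun z => ?_⟩
  rw [norm_mul, mul_assoc]
  gcongr
  exact hA z

/-! ### The model space as a closed subspace of L²(W_G) -/

section ModelSpace

variable {G : SymmetryGroup} {Δ : ℝ} {F H : ℂ → ℂ}

lemma modelSpace_memLp (hF : F ∈ modelSpace G Δ) : MemLp (fun x : ℝ => F x) 2 G.W := hF.2.2

lemma modelSpace_continuous_ofReal (hF : F ∈ modelSpace G Δ) : Continuous fun x : ℝ => F x :=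
  hF.1.continuous.comp Complex.continuous_ofReal

lemma modelSpace_add (hΔ : 0 < Δ) (hF : F ∈ modelSpace G Δ) (hH : H ∈ modelSpace G Δ) :
    (fun z => F z + H z) ∈ modelSpace G Δ :=
  ⟨hF.1.add hH.1, HasExpType.exponentialType_le (by positivity)
    (((mem_modelSpace_iff hΔ).1 hF).2.1.add ((mem_modelSpace_iff hΔ).1 hH).2.1),
    (modelSpace_memLp hF).add (modelSpace_memLp hH)⟩

lemma modelSpace_const_mul (hΔ : 0 < Δ) (hF : F ∈ modelSpace G Δ) (a : ℂ) :
    (fun z => a * F z) ∈ modelSpace G Δ :=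
  ⟨hF.1.const_mul a, HasExpType.exponentialType_le (by positivity)
    (((mem_modelSpace_iff hΔ).1 hF).2.1.const_mul a), (modelSpace_memLp hF).const_mul a⟩

lemma modelSpace_sub (hΔ : 0 < Δ) (hF : F ∈ modelSpace G Δ) (hH : H ∈ modelSpace G Δ) :
    (fun z => F z - H z) ∈ modelSpace G Δ := by
  have := modelSpace_add hΔ hF (modelSpace_const_mul hΔ hH (-1))
  simpa [sub_eq_add_neg] using this

lemma modelSpace_comp_neg (hΔ : 0 < Δ) (hF : F ∈ modelSpace G Δ) : (fun z => F (-z)) ∈ modelSpace G Δ := by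
  rw [mem_modelSpace_iff hΔ] at hF ⊢
  obtain ⟨h1, h2, h3⟩ := hF
  refine ⟨by fun_prop, h2.comp_neg, ?_⟩
  simpa using h3.comp_neg

lemma modelSpace_integrable_sq (hF : F ∈ modelSpace G Δ) : Integrable (fun x : ℝ => ‖F x‖ ^ 2) G.W :=
  (memLp_two_iff_integrable_sq_norm (modelSpace_continuous_ofReal hF).aestronglyMeasurable).1 (modelSpace_memLp hF)

lemma modelSpace_integrable_mul_conj (hF : F ∈ modelSpace G Δ) (hH : H ∈ modelSpace G Δ) :
    Integrable (fun x : ℝ => F x * conj (H x)) G.W :=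
  (modelSpace_memLp hF).integrable_mul (modelSpace_memLp hH).star

lemma modelSpace_exists_norm_le_Lp (G : SymmetryGroup) (hΔ : 0 < Δ) : ∃ C > 0, ∀ F ∈ modelSpace G Δ,
    ∀ f : Lp ℂ 2 G.W, f =ᵐ[G.W] (fun x : ℝ => F x) →
    ∀ z, ‖F z‖ ≤ C * ‖f‖ * Real.exp (Real.pi * Δ * |z.im|) := by
  obtain ⟨C, hC, h⟩ := G.exists_norm_le (τ := Real.pi * Δ) (by positivity)
  refine ⟨C, hC, fun F hF f hf z => ?_⟩
  obtain ⟨h1, h2, h3⟩ := (mem_modelSpace_iff hΔ).1 hF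
  have hnorm : ∫ x : ℝ, ‖F x‖ ^ 2 ∂G.W = ‖f‖ ^ 2 := by
    have e : (inner ℂ f f : ℂ) = ((∫ x : ℝ, ‖F x‖ ^ 2 ∂G.W : ℝ) : ℂ) := by
      rw [L2.inner_def, ← integral_complex_ofReal]
      refine integral_congr_ae ?_
      filter_upwards [hf] with x hx
      rw [hx, inner_self_eq_norm_sq_to_K]
      simp
    rw [inner_self_eq_norm_sq_to_K] at e
    have e' : ((‖f‖ ^ 2 : ℝ) : ℂ) = ((∫ x : ℝ, ‖F x‖ ^ 2 ∂G.W : ℝ) : ℂ) := by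
      rw [← e]; simp
    exact (Complex.ofReal_injective e').symm
  -- The previous bound needs N > 0, while ‖f‖ may be 0; hence the limit N ↓ ‖f‖.
  have key : ∀ N > ‖f‖, ‖F z‖ ≤ C * N * Real.exp (Real.pi * Δ * |z.im|) := fun N hN =>
    h F h1 h2 h3 N ((norm_nonneg _).trans_lt hN) (by
      rw [hnorm]; gcongr) z
  have ht : Tendsto (fun N : ℝ => C * N * Real.exp (Real.pi * Δ * |z.im|)) (𝓝[>] ‖f‖)
      (𝓝 (C * ‖f‖ * Real.exp (Real.pi * Δ * |z.im|))) :=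
    Tendsto.mono_left (Continuous.tendsto (by fun_prop) _) nhdsWithin_le_nhds
  exact ge_of_tendsto ht (by filter_upwards [self_mem_nhdsWithin] with N hN using key N hN)

lemma modelSpace_eq_zero_of_ae (hΔ : 0 < Δ) (hF : F ∈ modelSpace G Δ)
    (h0 : (fun x : ℝ => F x) =ᵐ[G.W] 0) : F = 0 := by
  obtain ⟨C, hC, h⟩ := modelSpace_exists_norm_le_Lp G hΔ
  funext z
  have := h F hF 0 ((Lp.coeFn_zero _ _ _).trans h0.symm) z
  simpa using this

lemma modelSpace_eq_zero_of_integral_mul_conj (hΔ : 0 < Δ) (hF : F ∈ modelSpace G Δ)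
    (h0 : ∫ x : ℝ, F x * conj (F x) ∂G.W = 0) : F = 0 := by
  refine modelSpace_eq_zero_of_ae hΔ hF ?_
  have e : ∫ x : ℝ, ‖F x‖ ^ 2 ∂G.W = 0 := by
    have : ((∫ x : ℝ, ‖F x‖ ^ 2 ∂G.W : ℝ) : ℂ) = 0 := by
      rw [← h0, ← integral_complex_ofReal]
      refine integral_congr_ae (Eventually.of_forall fun x => ?_)
      simp [Complex.mul_conj, Complex.normSq_eq_norm_sq]
    exact_mod_cast this
  rw [integral_eq_zero_iff_of_nonneg (fun x => by positivity) (modelSpace_integrable_sq hF)] at e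
  filter_upwards [e] with x hx
  simpa using hx

/-- The model space as a subspace of `L²(W_G)`. -/
def modelSpace_toSubmodule (G : SymmetryGroup) (hΔ : 0 < Δ) : Submodule ℂ (Lp ℂ 2 G.W) where
  carrier := {f | ∃ F ∈ modelSpace G Δ, f =ᵐ[G.W] fun x : ℝ => F x}
  add_mem' := by
    rintro f g ⟨F, hF, hf⟩ ⟨H, hH, hg⟩
    exact ⟨_, modelSpace_add hΔ hF hH, (Lp.coeFn_add f g).trans (hf.add hg)⟩
  zero_mem' := ⟨fun _ => 0, (mem_modelSpace_iff hΔ).2 ⟨by fun_prop, fun s _ =>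
    ⟨0, by simp⟩, by simp⟩, Lp.coeFn_zero _ _ _⟩
  smul_mem' := by
    rintro a f ⟨F, hF, hf⟩
    refine ⟨_, modelSpace_const_mul hΔ hF a, (Lp.coeFn_smul a f).trans ?_⟩
    filter_upwards [hf] with x hx
    simp [hx]

/-- Convergence in L²(W_G) forces locally uniform convergence of the entire representatives, so
their limit is entire, and the pointwise bound passes to it and keeps its type at most πΔ. -/
lemma isClosed_modelSpace_toSubmodule (G : SymmetryGroup) (hΔ : 0 < Δ) :
    IsClosed (modelSpace_toSubmodule G hΔ : Set (Lp ℂ 2 G.W)) := by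
  obtain ⟨C, hC, hb⟩ := modelSpace_exists_norm_le_Lp G hΔ
  refine IsSeqClosed.isClosed fun f g hf hlim => ?_
  choose F hF hfF using hf
  have hsub : ∀ n m z, ‖F n z - F m z‖ ≤ C * ‖f n - f m‖ * Real.exp (Real.pi * Δ * |z.im|) :=
    fun n m z => hb _ (modelSpace_sub hΔ (hF n) (hF m)) (f n - f m)
      ((Lp.coeFn_sub _ _).trans ((hfF n).sub (hfF m))) z
  have hlim' : ∀ z, ∃ y, Tendsto (fun n => F n z) atTop (𝓝 y) := by
    refine fun z => cauchySeq_tendsto_of_complete ?_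
    rw [Metric.cauchySeq_iff]
    intro ε hε
    obtain ⟨N, hN⟩ := Metric.cauchySeq_iff.1 hlim.cauchySeq
      (ε / (C * Real.exp (Real.pi * Δ * |z.im|))) (by positivity)
    refine ⟨N, fun m hm n hn => ?_⟩
    have h1 := hN m hm n hn
    rw [dist_eq_norm] at h1 ⊢
    rw [lt_div_iff₀ (by positivity)] at h1
    refine (hsub m n z).trans_lt ?_
    linarith
  choose Φ hΦ using hlim'
  have hrate : ∀ n z, ‖F n z - Φ z‖ ≤ C * ‖f n - g‖ * Real.exp (Real.pi * Δ * |z.im|) :=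
    fun n z => le_of_tendsto_of_tendsto' (tendsto_const_nhds.sub (hΦ z)).norm
      (((tendsto_const_nhds.sub hlim).norm.const_mul C).mul_const _) fun m => hsub n m z
  have hloc : TendstoLocallyUniformlyOn F Φ atTop univ := by
    rw [tendstoLocallyUniformlyOn_iff_forall_isCompact isOpen_univ]
    intro K _ hK
    obtain ⟨R, hR⟩ := hK.exists_bound_of_continuousOn Complex.continuous_im.continuousOn
    rw [Metric.tendstoUniformlyOn_iff]
    intro ε hε
    have ht : Tendsto (fun n => C * ‖f n - g‖ * Real.exp (Real.pi * Δ * R)) atTop (𝓝 0) := by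
      simpa using ((tendsto_iff_norm_sub_tendsto_zero.1 hlim).const_mul C).mul_const
        (Real.exp (Real.pi * Δ * R))
    filter_upwards [ht.eventually_lt_const hε] with n hn z hz
    rw [dist_comm, dist_eq_norm]
    refine ((hrate n z).trans ?_).trans_lt hn
    gcongr
    simpa using hR z hz
  have hΦd : Differentiable ℂ Φ := by
    rw [← differentiableOn_univ]
    exact hloc.differentiableOn (Eventually.of_forall fun n => (hF n).1.differentiableOn) isOpen_univ
  have hΦb : ∀ z, ‖Φ z‖ ≤ C * ‖g‖ * Real.exp (Real.pi * Δ * |z.im|) := fun z =>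
    le_of_tendsto_of_tendsto' (hΦ z).norm ((hlim.norm.const_mul C).mul_const _)
      fun n => hb _ (hF n) _ (hfF n) z
  -- A subsequence converges a.e. to `g`, and everywhere to `Φ`.
  have hae : g =ᵐ[G.W] fun x : ℝ => Φ x := by
    obtain ⟨ns, hns, hconv⟩ := (tendstoInMeasure_of_tendsto_Lp hlim).exists_seq_tendsto_ae
    have hall : ∀ᵐ x ∂G.W, ∀ n, f n x = F n x := ae_all_iff.2 hfF
    filter_upwards [hconv, hall] with x hx hx'
    refine tendsto_nhds_unique hx ?_
    simp only [hx']
    exact (hΦ x).comp hns.tendsto_atTop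
  exact ⟨Φ, ⟨hΦd, HasExpType.exponentialType_le (by positivity)
    (hasExpType_of_norm_le_exp_im (by positivity) hΦb), (memLp_congr_ae hae).1 (Lp.memLp g)⟩, hae⟩

end ModelSpace

/-! ### The reproducing kernel: existence, uniqueness, symmetries -/

theorem exists_isReproducingKernel (G : SymmetryGroup) {Δ : ℝ} (hΔ : 0 < Δ) :
    ∃ K, IsReproducingKernel G Δ K := by
  obtain ⟨C, hC, hb⟩ := modelSpace_exists_norm_le_Lp G hΔ
  set S := modelSpace_toSubmodule G hΔ with hS
  have : CompleteSpace S := (isClosed_modelSpace_toSubmodule G hΔ).completeSpace_coe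
  choose rep hrep hrepae using fun f : S => f.2
  have huniq : ∀ (f : S) (F : ℂ → ℂ), F ∈ modelSpace G Δ →
      (f : Lp ℂ 2 G.W) =ᵐ[G.W] (fun x : ℝ => F x) → rep f = F := by
    intro f F hF hf
    have := modelSpace_eq_zero_of_ae hΔ (modelSpace_sub hΔ (hrep f) hF) (by
      filter_upwards [hrepae f, hf] with x h1 h2
      rw [← h1, ← h2]; simp)
    exact funext fun z => sub_eq_zero.1 (congrFun this z)
  -- Evaluation at w is linear because the entire representative of a class is unique, and
  -- continuous by the pointwise bound; its Riesz vector is K(w,·).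
  let ev : ℂ → StrongDual ℂ S := fun w => LinearMap.mkContinuous
    { toFun := fun f => rep f w
      map_add' := fun f g => by
        rw [huniq (f + g) _ (modelSpace_add hΔ (hrep f) (hrep g))
          ((Lp.coeFn_add (f : Lp ℂ 2 G.W) g).trans ((hrepae f).add (hrepae g)))]
      map_smul' := fun a f => by
        rw [huniq (a • f) _ (modelSpace_const_mul hΔ (hrep f) a) ?_]
        · simp
        · refine (Lp.coeFn_smul a (f : Lp ℂ 2 G.W)).trans ?_
          filter_upwards [hrepae f] with x hx
          simp [hx] }
    (C * Real.exp (Real.pi * Δ * |w.im|)) (fun f => by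
      refine (hb _ (hrep f) f (hrepae f) w).trans_eq ?_
      rw [Submodule.coe_norm]; ring)
  refine ⟨fun w => rep ((InnerProductSpace.toDual ℂ S).symm (ev w)), fun w => ⟨hrep _, ?_⟩⟩
  intro F hF
  set k := (InnerProductSpace.toDual ℂ S).symm (ev w) with hk
  let f : S := ⟨(modelSpace_memLp hF).toLp _, F, hF, (modelSpace_memLp hF).coeFn_toLp⟩
  have h1 : inner ℂ k f = F w := by
    rw [hk, InnerProductSpace.toDual_symm_apply]
    change rep f w = F w
    rw [huniq f F hF (modelSpace_memLp hF).coeFn_toLp]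
  rw [← h1, Submodule.coe_inner, L2.inner_def]
  refine integral_congr_ae ?_
  filter_upwards [hrepae k, (modelSpace_memLp hF).coeFn_toLp] with x h2 h3
  rw [h2, h3, RCLike.inner_apply]

namespace IsReproducingKernel

variable {G : SymmetryGroup} {Δ : ℝ} {K K' : ℂ → ℂ → ℂ}

lemma unique (hΔ : 0 < Δ) (hK : IsReproducingKernel G Δ K) (hK' : IsReproducingKernel G Δ K') :
    K = K' := by
  funext w
  have hD := modelSpace_sub hΔ (hK w).1 (hK' w).1
  have h0 := modelSpace_eq_zero_of_integral_mul_conj hΔ hD (by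
    have e1 := (hK w).2 _ hD
    have e2 := (hK' w).2 _ hD
    rw [e1] at e2
    simp only [map_sub, mul_sub]
    rw [integral_sub (modelSpace_integrable_mul_conj hD (hK w).1) (modelSpace_integrable_mul_conj hD (hK' w).1), e2,
      sub_self])
  exact funext fun z => sub_eq_zero.1 (congrFun h0 z)

lemma _root_.SymmetryGroup.map_neg_W (G : SymmetryGroup) : G.W.map Neg.neg = G.W := by
  have hd := G.continuous_density.measurable
  rw [G.W_eq, Measure.map_add _ _ measurable_neg, Measure.map_smul, Measure.map_dirac' measurable_neg]
  congr 1
  · ext s hs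
    rw [Measure.map_apply measurable_neg hs, withDensity_apply _ (measurable_neg hs),
      withDensity_apply _ hs]
    have := (Measure.measurePreserving_neg (volume : Measure ℝ)).setLIntegral_comp_preimage hs
      (f := fun x => ENNReal.ofReal (G.density x)) (by fun_prop)
    simpa [G.density_neg] using this
  · simp

/-- W_G is even and the space is stable under z ↦ -z, so the reflected kernel also reproduces;
uniqueness concludes. -/
lemma neg_neg (hΔ : 0 < Δ) (hK : IsReproducingKernel G Δ K) (w z : ℂ) : K (-w) (-z) = K w z := by
  have h : IsReproducingKernel G Δ (fun w z => K (-w) (-z)) := by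
    refine fun w => ⟨modelSpace_comp_neg hΔ (hK (-w)).1, fun F hF => ?_⟩
    have := (hK (-w)).2 _ (modelSpace_comp_neg hΔ hF)
    rw [_root_.neg_neg] at this
    rw [this]
    have hc : Continuous fun x : ℝ => F (-x) * conj (K (-w) x) :=
      (modelSpace_continuous_ofReal (modelSpace_comp_neg hΔ hF)).mul
        (Complex.continuous_conj.comp (modelSpace_continuous_ofReal (hK (-w)).1))
    nth_rewrite 1 [← G.map_neg_W]
    rw [integral_map measurable_neg.aemeasurable hc.aestronglyMeasurable]
    simp
  exact congrFun (congrFun (h.unique hΔ hK) w) z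

lemma conj_symm (hK : IsReproducingKernel G Δ K) (w z : ℂ) : conj (K w z) = K z w := by
  rw [(hK w).2 _ (hK z).1, (hK z).2 _ (hK w).1, ← integral_conj]
  simp [mul_comm]

end IsReproducingKernel

/-! ### Band-limited Schwartz test functions -/

lemma HasExpType.comp_const_mul {σ r : ℝ} (hr : 0 < r) {F : ℂ → ℂ} (hF : HasExpType σ F) :
    HasExpType (σ * r) (fun z => F (r * z)) := by
  intro s hs
  obtain ⟨B, hB⟩ := hF (s / r) (by rwa [gt_iff_lt, lt_div_iff₀ hr])
  refine ⟨B, fun z => (hB _).trans_eq ?_⟩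
  rw [norm_mul, Complex.norm_real, Real.norm_eq_abs, abs_of_pos hr, ← mul_assoc,
    div_mul_cancel₀ _ hr.ne']

lemma HasExpType.conj_conj {σ : ℝ} {F : ℂ → ℂ} (hF : HasExpType σ F) :
    HasExpType σ (fun z => conj (F (conj z))) := by
  intro s hs
  obtain ⟨B, hB⟩ := hF s hs
  refine ⟨B, fun z => ?_⟩
  simpa using hB (conj z)

lemma hasExpType_add_const (a : ℂ) : HasExpType 0 (fun z => z + a) := by
  intro s hs
  have hs : 0 < s := hs
  refine ⟨‖a‖ + s⁻¹, fun z => (norm_add_le _ _).trans ?_⟩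
  have h1 := Real.add_one_le_exp (s * ‖z‖)
  have h2 : ‖z‖ + ‖a‖ ≤ (‖a‖ + s⁻¹) * (s * ‖z‖ + 1) := by
    have : s⁻¹ * s = 1 := inv_mul_cancel₀ hs.ne'
    have h3 : 0 ≤ ‖a‖ * (s * ‖z‖) := by positivity
    have h4 : 0 ≤ s⁻¹ := by positivity
    have h5 : (‖a‖ + s⁻¹) * (s * ‖z‖ + 1) = ‖a‖ * (s * ‖z‖) + ‖a‖ + s⁻¹ * s * ‖z‖ + s⁻¹ := by ring
    rw [h5, this]
    linarith
  exact h2.trans (by gcongr)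

/-- Cauchy's estimates on unit circles centred on ℝ bound the n-th derivative by n!·C. -/
lemma hasTemperateGrowth_of_bounded_on_strip {A : ℂ → ℂ} (hd : Differentiable ℂ A) {C : ℝ}
    (hC : ∀ z : ℂ, |z.im| ≤ 1 → ‖A z‖ ≤ C) :
    (fun x : ℝ => A x).HasTemperateGrowth := by
  have hit : ∀ n, iteratedDeriv n (fun x : ℝ => A x) = fun x : ℝ => iteratedDeriv n A x := by
    intro n
    induction n with
    | zero => simp
    | succ n ih =>
      funext x
      rw [iteratedDeriv_succ, iteratedDeriv_succ, ih]
      have : DifferentiableAt ℂ (iteratedDeriv n A) x :=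
        ((hd.contDiff (n := n + 1)).differentiable_iteratedDeriv n (by exact_mod_cast n.lt_succ_self)) x
      exact this.hasDerivAt.comp_ofReal.deriv
  refine ⟨((hd.contDiff (n := (⊤ : ℕ∞))).restrict_scalars ℝ).comp Complex.ofRealCLM.contDiff,
    fun n => ⟨0, n.factorial * C / 1 ^ n, fun x => ?_⟩⟩
  rw [norm_iteratedFDeriv_eq_norm_iteratedDeriv, hit, pow_zero, mul_one]
  refine Complex.norm_iteratedDeriv_le_of_forall_mem_sphere_norm_le n one_pos hd.diffContOnCl
    fun z hz => hC z ?_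
  have h1 : ‖z - x‖ = 1 := by simpa [dist_eq_norm] using hz
  rw [← h1]
  simpa using Complex.abs_im_le_norm (z - x)

/-- An even real Schwartz function with value `1` at `0` that extends to an entire function of
exponential type `2π`. -/
lemma exists_entire_schwartz : ∃ (H : ℂ → ℂ) (h : 𝓢(ℝ, ℝ)), Differentiable ℂ H ∧
    (∀ z, ‖H z‖ ≤ Real.exp (2 * Real.pi * |z.im|)) ∧ (∀ x : ℝ, H x = h x) ∧
    (∀ x, h (-x) = h x) ∧ h 0 = 1 := by
  let b : ContDiffBump (0 : ℝ) := ⟨1 / 2, 1, by norm_num, by norm_num⟩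
  -- `H` will be the Fourier–Laplace transform of a normalized even bump supported in [-1, 1]: the
  -- support gives type 2π, and total mass 1 gives H(0) = 1.
  set ψ : ℝ → ℝ := b.normed volume with hψ
  have hψ0 : ∀ y, 0 ≤ ψ y := b.nonneg_normed
  have hψi : Integrable ψ := b.integrable_normed
  have hψ1 : ∫ y, ψ y = 1 := b.integral_normed
  have hψc : Continuous ψ := b.continuous_normed
  have hψs : ∀ y, ψ y ≠ 0 → |y| < 1 := by
    intro y hy
    have : y ∈ Function.support ψ := hy
    rw [hψ, b.support_normed_eq] at this
    simpa [b] using this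
  set H : ℂ → ℂ := fun z => ∫ y : ℝ, Complex.exp (-2 * Real.pi * Complex.I * y * z) * ψ y with hH
  have hnorm : ∀ (z : ℂ) (y : ℝ), ‖Complex.exp (-2 * Real.pi * Complex.I * y * z) * ψ y‖ ≤
      Real.exp (2 * Real.pi * |z.im|) * ψ y := by
    intro z y
    rw [norm_mul, Complex.norm_exp, Complex.norm_real, Real.norm_eq_abs, abs_of_nonneg (hψ0 y)]
    rcases eq_or_ne (ψ y) 0 with h0 | h0
    · simp [h0]
    refine mul_le_mul_of_nonneg_right (Real.exp_le_exp.2 ?_) (hψ0 y)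
    have : (-2 * Real.pi * Complex.I * y * z).re = 2 * Real.pi * (y * z.im) := by
      simp [Complex.mul_re, Complex.mul_im]; ring
    rw [this]
    gcongr
    refine (le_abs_self _).trans ?_
    rw [abs_mul]
    exact mul_le_of_le_one_left (abs_nonneg _) (hψs y h0).le
  have hmeas : ∀ z : ℂ, Continuous fun y : ℝ => Complex.exp (-2 * Real.pi * Complex.I * y * z) * ψ y :=
    fun z => by fun_prop
  have hint : ∀ z : ℂ, Integrable fun y : ℝ => Complex.exp (-2 * Real.pi * Complex.I * y * z) * ψ y :=
    fun z => (hψi.const_mul _).mono' (hmeas z).aestronglyMeasurable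
      (Eventually.of_forall fun y => hnorm z y)
  have hbound : ∀ z, ‖H z‖ ≤ Real.exp (2 * Real.pi * |z.im|) := by
    intro z
    refine (norm_integral_le_of_norm_le (hψi.const_mul _)
      (Eventually.of_forall fun y => hnorm z y)).trans_eq ?_
    rw [integral_const_mul, hψ1, mul_one]
  have hHd : Differentiable ℂ H := by
    intro z₀
    have hder : ∀ (y : ℝ) (z : ℂ), HasDerivAt
        (fun z => Complex.exp (-2 * Real.pi * Complex.I * y * z) * ψ y)
        ((-2 * Real.pi * Complex.I * y) * (Complex.exp (-2 * Real.pi * Complex.I * y * z) * ψ y)) z := by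
      intro y z
      exact ((((hasDerivAt_id' z).const_mul (-2 * Real.pi * Complex.I * y)).cexp).mul_const
        (ψ y : ℂ)).congr_deriv (by ring)
    refine (hasDerivAt_integral_of_dominated_loc_of_deriv_le (μ := volume)
      (bound := fun y => 2 * Real.pi * (Real.exp (2 * Real.pi * (|z₀.im| + 1)) * ψ y))
      (F' := fun z (y : ℝ) => (-2 * Real.pi * Complex.I * y) *
        (Complex.exp (-2 * Real.pi * Complex.I * y * z) * ψ y))
      (Metric.ball_mem_nhds z₀ one_pos) (Eventually.of_forall fun z => (hmeas z).aestronglyMeasurable)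
      (hint z₀) (Continuous.aestronglyMeasurable (by fun_prop))
      (Eventually.of_forall fun y z hz => ?_) ((hψi.const_mul _).const_mul _)
      (Eventually.of_forall fun y z _ => hder y z)).2.differentiableAt
    rcases eq_or_ne (ψ y) 0 with h0 | h0
    · simp [h0]
    rw [norm_mul]
    have e1 : ‖(-2 * Real.pi * Complex.I * y : ℂ)‖ ≤ 2 * Real.pi := by
      simp only [norm_mul, norm_neg, Complex.norm_ofNat, Complex.norm_real, Complex.norm_I,
        Real.norm_eq_abs, mul_one, abs_of_pos Real.pi_pos]
      exact mul_le_of_le_one_right (by positivity) (hψs y h0).le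
    refine mul_le_mul e1 ((hnorm z y).trans ?_) (norm_nonneg _) (by positivity)
    have := hψ0 y
    gcongr
    have h1 : |(z - z₀).im| ≤ 1 :=
      (Complex.abs_im_le_norm _).trans (by simpa [dist_eq_norm] using (Metric.mem_ball.1 hz).le)
    rw [Complex.sub_im] at h1
    have h2 := abs_add_le (z.im - z₀.im) z₀.im
    rw [sub_add_cancel] at h2
    linarith
  have hcs : HasCompactSupport fun y => (ψ y : ℂ) :=
    b.hasCompactSupport_normed.comp_left (g := fun x : ℝ => (x : ℂ)) Complex.ofReal_zero
  have hsm : ContDiff ℝ (⊤ : ℕ∞) fun y => (ψ y : ℂ) := Complex.ofRealCLM.contDiff.comp b.contDiff_normed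
  let Hs : 𝓢(ℝ, ℂ) := 𝓕 (hcs.toSchwartzMap hsm)
  have hHs : ∀ x : ℝ, Hs x = H x := by
    intro x
    change 𝓕 (hcs.toSchwartzMap hsm) x = _
    rw [SchwartzMap.fourier_coe, Real.fourier_real_eq_integral_exp_smul]
    refine integral_congr_ae (Eventually.of_forall fun y => ?_)
    simp only [HasCompactSupport.toSchwartzMap_toFun, smul_eq_mul]
    push_cast
    ring_nf
  have heven : ∀ z, H (-z) = H z := by
    intro z
    simp only [hH]
    rw [← integral_neg_eq_self]
    refine integral_congr_ae (Eventually.of_forall fun y => ?_)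
    have : ψ (-y) = ψ y := b.normed_neg y
    simp only [this]
    push_cast
    ring_nf
  have hreal : ∀ x : ℝ, conj (H x) = H x := by
    intro x
    conv_rhs => rw [← heven x]
    simp only [hH]
    rw [← integral_conj]
    refine integral_congr_ae (Eventually.of_forall fun y => ?_)
    have : conj (-2 * Real.pi * Complex.I * y * x) = -2 * Real.pi * Complex.I * y * -x := by
      simp only [map_mul, map_neg, map_ofNat, Complex.conj_ofReal, Complex.conj_I]
      ring
    dsimp only
    rw [map_mul, ← Complex.exp_conj, Complex.conj_ofReal]
    simpa only [Complex.conj_ofReal] using congrArg (fun w => Complex.exp w * (ψ y : ℂ)) this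
  have hre : ∀ x : ℝ, H x = ((H x).re : ℂ) := fun x => (Complex.conj_eq_iff_re.1 (hreal x)).symm
  refine ⟨H, Hs.postcompCLM Complex.reCLM, hHd, hbound, fun x => ?_, fun x => ?_, ?_⟩
  · rw [SchwartzMap.postcompCLM_apply, hHs]; exact hre x
  · simp only [SchwartzMap.postcompCLM_apply, hHs]
    push_cast
    rw [heven]
  · simp only [SchwartzMap.postcompCLM_apply, hHs]
    have : H ((0 : ℝ) : ℂ) = 1 := by
      simp only [hH, Complex.ofReal_zero, mul_zero, Complex.exp_zero, one_mul]
      rw [integral_complex_ofReal, hψ1, Complex.ofReal_one]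
    rw [this]; simp

/-- One half of the **Paley–Wiener theorem** for Schwartz functions. -/
lemma fourier_eq_zero_of_hasExpType {φ : 𝓢(ℝ, ℝ)} {Φ : ℂ → ℂ} (hd : Differentiable ℂ Φ)
    (hΦ : ∀ x : ℝ, Φ x = φ x) {σ : ℝ} (hσ : HasExpType σ Φ) {ξ : ℝ}
    (hξ : 2 * Real.pi * ξ < -σ) : 𝓕 (fun x : ℝ => (φ x : ℂ)) ξ = 0 := by
  obtain ⟨M₀, hM₀⟩ := φ.decay 0 0
  obtain ⟨M₂, hM₂⟩ := φ.decay 2 0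
  -- The factor (z + i)² leaves the type unchanged, and the quadratic decay of φ makes the product
  -- bounded on ℝ. As |z + i|² ≥ 1 + (Re z)² for Im z ≥ 0, dividing it out gives the decay required
  -- by the contour shift.
  set P : ℂ → ℂ := fun z => (z + Complex.I) * (z + Complex.I) * Φ z with hP
  have hPt : HasExpType σ P := by
    have := ((hasExpType_add_const Complex.I).mul (hasExpType_add_const Complex.I)).mul hσ
    simpa using this
  have hPr : ∀ x : ℝ, ‖P x‖ ≤ M₂ + M₀ := by
    intro x
    have h0 := hM₀.2 x
    have h2 := hM₂.2 x
    simp only [pow_zero, one_mul, norm_iteratedFDeriv_zero] at h0 h2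
    rw [hP]
    simp only [norm_mul, hΦ, Complex.norm_real]
    have : ‖(x : ℂ) + Complex.I‖ * ‖(x : ℂ) + Complex.I‖ = x ^ 2 + 1 := by
      rw [← sq, Complex.sq_norm, Complex.normSq_apply]
      simp; ring
    rw [this]
    have e : ‖x‖ ^ 2 = x ^ 2 := by simp
    rw [e] at h2
    linarith
  rw [Real.fourier_real_eq_integral_exp_smul]
  have := integral_eq_zero_of_decay_upper (M := M₂ + M₀) (a := -(σ + 2 * Real.pi * ξ))
    (g := fun z => Complex.exp (-2 * Real.pi * Complex.I * ξ * z) * Φ z) (by fun_prop) (by linarith)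
    (fun z hz => ?_)
  · rw [← this]
    refine integral_congr_ae (Eventually.of_forall fun x => ?_)
    simp only [smul_eq_mul, hΦ]
    push_cast
    ring_nf
  · have h1 := norm_le_of_upper (by fun_prop) hPt hPr hz
    rw [hP] at h1
    simp only [norm_mul] at h1
    have h2 : 1 + z.re ^ 2 ≤ ‖z + Complex.I‖ * ‖z + Complex.I‖ := by
      rw [← sq, Complex.sq_norm, Complex.normSq_apply]
      simp
      nlinarith
    have h3 : (1 + z.re ^ 2) * ‖Φ z‖ ≤ (M₂ + M₀) * Real.exp (σ * z.im) :=
      (mul_le_mul_of_nonneg_right h2 (norm_nonneg _)).trans h1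
    rw [le_div_iff₀ (by positivity), norm_mul, Complex.norm_exp]
    have e : (-2 * Real.pi * Complex.I * ξ * z).re = 2 * Real.pi * ξ * z.im := by
      simp [Complex.mul_re, Complex.mul_im]
    have e2 : Real.exp (-(-(σ + 2 * Real.pi * ξ)) * z.im) =
        Real.exp (2 * Real.pi * ξ * z.im) * Real.exp (σ * z.im) := by
      rw [← Real.exp_add]; ring_nf
    rw [e, e2]
    calc _ = Real.exp (2 * Real.pi * ξ * z.im) * ((1 + z.re ^ 2) * ‖Φ z‖) := by ring
      _ ≤ Real.exp (2 * Real.pi * ξ * z.im) * ((M₂ + M₀) * Real.exp (σ * z.im)) := by gcongr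
      _ = _ := by ring

lemma tsupport_fourier_subset {φ : 𝓢(ℝ, ℝ)} (heven : ∀ x, φ (-x) = φ x) {Φ : ℂ → ℂ}
    (hd : Differentiable ℂ Φ) (hΦ : ∀ x : ℝ, Φ x = φ x) {σ Δ : ℝ} (hσ : HasExpType σ Φ)
    (hσΔ : σ < 2 * Real.pi * Δ) :
    tsupport (𝓕 (fun x : ℝ => (φ x : ℂ))) ⊆ Ioo (-Δ) Δ := by
  have hpi : 0 < 2 * Real.pi := by positivity
  set δ := σ / (2 * Real.pi) with hδ
  have hδΔ : δ < Δ := by rwa [hδ, div_lt_iff₀' hpi]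
  refine (closure_minimal (t := Icc (-δ) δ) ?_ isClosed_Icc).trans
    (Icc_subset_Ioo (by linarith) hδΔ)
  intro ξ hξ
  have hσδ : σ = 2 * Real.pi * δ := by rw [hδ]; field_simp
  have hneg : 𝓕 (fun x : ℝ => (φ x : ℂ)) (-ξ) = 𝓕 (fun x : ℝ => (φ x : ℂ)) ξ := by
    rw [Real.fourier_real_eq_integral_exp_smul, Real.fourier_real_eq_integral_exp_smul,
      ← integral_neg_eq_self]
    refine integral_congr_ae (Eventually.of_forall fun x => ?_)
    simp only [heven]
    ring_nf
  constructor
  · by_contra h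
    refine hξ (fourier_eq_zero_of_hasExpType hd hΦ hσ ?_)
    rw [hσδ]; nlinarith
  · by_contra h
    refine hξ (hneg ▸ fourier_eq_zero_of_hasExpType hd hΦ hσ ?_)
    rw [hσδ]; nlinarith

/-- Band-limited Schwartz majorants of dilated squares of elements of the model space. -/
lemma exists_testFunction {G : SymmetryGroup} {Δ : ℝ} (hΔ : 0 < Δ) {F : ℂ → ℂ}
    (hF : F ∈ modelSpace G Δ) (heven : ∀ x : ℝ, ‖F (-x)‖ = ‖F x‖) {H : ℂ → ℂ} {h : 𝓢(ℝ, ℝ)}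
    (hHd : Differentiable ℂ H) (hHb : ∀ z, ‖H z‖ ≤ Real.exp (2 * Real.pi * |z.im|))
    (hHh : ∀ x : ℝ, H x = h x) (hh : ∀ x, h (-x) = h x) {r : ℝ} (hr : 0 < r) (hr1 : r < 1) :
    ∃ φ : 𝓢(ℝ, ℝ), (∀ x, φ x = ‖F (r * x)‖ ^ 2 * h (Δ * (1 - r) / 4 * x) ^ 2) ∧
      (∀ x, φ (-x) = φ x) ∧ tsupport (𝓕 (fun x : ℝ => (φ x : ℂ))) ⊆ Ioo (-Δ) Δ := by
  obtain ⟨hFd, hFt, hFi⟩ := (mem_modelSpace_iff hΔ).1 hF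
  obtain ⟨C, hC, hb⟩ := modelSpace_exists_norm_le_Lp G hΔ
  set B := C * ‖(modelSpace_memLp hF).toLp‖ with hB
  have hB0 : 0 ≤ B := by positivity
  have hFb : ∀ z, ‖F z‖ ≤ B * Real.exp (Real.pi * Δ * |z.im|) :=
    hb F hF _ (modelSpace_memLp hF).coeFn_toLp
  -- The total type is 2·πΔr + 2·2πε = πΔ(1 + r), strictly below 2πΔ.
  set ε := Δ * (1 - r) / 4 with hε
  have hεpos : 0 < ε := by have := sub_pos.2 hr1; positivity
  -- `F` is bounded on horizontal strips, so it is a multiplier of Schwartz functions.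
  have hA : (fun x : ℝ => F (r * x)).HasTemperateGrowth := by
    refine hasTemperateGrowth_of_bounded_on_strip (A := fun z => F (r * z)) (by fun_prop)
      (C := B * Real.exp (Real.pi * Δ * r)) fun z hz => (hFb _).trans ?_
    gcongr
    rw [Complex.im_ofReal_mul, abs_mul, abs_of_pos hr]
    exact mul_le_of_le_one_right hr.le hz
  have hA2 : (fun x : ℝ => ‖F (r * x)‖ ^ 2).HasTemperateGrowth :=
    (Function.hasTemperateGrowth_norm_sq (H := ℂ)).comp hA
  let hε' : 𝓢(ℝ, ℝ) := SchwartzMap.compCLMOfContinuousLinearEquiv ℝ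
    (ContinuousLinearEquiv.unitsEquivAut ℝ (Units.mk0 ε hεpos.ne')) h
  have hε'a : ∀ x, hε' x = h (ε * x) := fun x => by
    simp [hε', mul_comm]
  let φ : 𝓢(ℝ, ℝ) := SchwartzMap.smulLeftCLM ℝ (fun x : ℝ => ‖F (r * x)‖ ^ 2)
    (SchwartzMap.smulLeftCLM ℝ hε' hε')
  have hφ : ∀ x, φ x = ‖F (r * x)‖ ^ 2 * h (ε * x) ^ 2 := fun x => by
    simp only [φ]
    rw [SchwartzMap.smulLeftCLM_apply_apply hA2,
      SchwartzMap.smulLeftCLM_apply_apply hε'.hasTemperateGrowth, hε'a]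
    simp [sq]
  have hφe : ∀ x, φ (-x) = φ x := fun x => by
    rw [hφ, hφ, mul_neg, hh]
    have := heven (r * x)
    push_cast at this ⊢
    rw [mul_neg, this]
  refine ⟨φ, hφ, hφe, ?_⟩
  set Φ : ℂ → ℂ := fun z => (F (r * z) * conj (F (r * conj z))) * (H (ε * z) * H (ε * z)) with hΦ
  have hconj : Differentiable ℂ fun z => conj (F (r * conj z)) := by
    intro z
    have : DifferentiableAt ℂ (fun z => F (r * z)) (conj z) := by fun_prop
    simpa [Function.comp_def] using this.conj_conj
  refine tsupport_fourier_subset hφe (Φ := Φ) (σ := Real.pi * Δ * (1 + r)) (by fun_prop)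
    (fun x => ?_) ?_ (by nlinarith [Real.pi_pos, mul_pos Real.pi_pos hΔ])
  · simp only [hΦ, Complex.conj_ofReal, Complex.mul_conj, Complex.normSq_eq_norm_sq]
    rw [hφ, ← Complex.ofReal_mul, ← Complex.ofReal_mul, hHh]
    push_cast; ring
  · have h1 : HasExpType (Real.pi * Δ * r) fun z => F (r * z) := hFt.comp_const_mul hr
    have h2 : HasExpType (2 * Real.pi * ε) fun z => H (ε * z) :=
      (hasExpType_of_norm_le_exp_im (C := 1) (by positivity) (by simpa using hHb)).comp_const_mul hεpos
    have h3 := (h1.mul h1.conj_conj).mul (h2.mul h2)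
    refine h3.mono (le_of_eq ?_)
    rw [hε]; ring

/-! ### Zeros of Λ and of L on the critical line -/

lemma analyticAt_Gammaℝ {s : ℂ} (hs : Complex.Gammaℝ s ≠ 0) : AnalyticAt ℂ Complex.Gammaℝ s := by
  have h := (Complex.differentiable_Gammaℝ_inv.analyticAt s).inv (inv_ne_zero hs)
  have e : (fun s => (Complex.Gammaℝ s)⁻¹)⁻¹ = Complex.Gammaℝ := by
    funext z; simp
  rwa [e] at h

lemma analyticAt_multiset_prod_Gammaℝ {m : Multiset ℂ} {s : ℂ}
    (hs : (m.map fun k => Complex.Gammaℝ (s + k)).prod ≠ 0) :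
    AnalyticAt ℂ (fun s => (m.map fun k => Complex.Gammaℝ (s + k)).prod) s := by
  induction m using Multiset.induction_on with
  | empty => simpa using analyticAt_const
  | cons a m ih =>
    simp only [Multiset.map_cons, Multiset.prod_cons] at hs ⊢
    have ha : AnalyticAt ℂ (fun s : ℂ => Complex.Gammaℝ (s + a)) s :=
      (analyticAt_Gammaℝ (left_ne_zero_of_mul hs)).fun_comp (f := fun s => s + a)
        (analyticAt_id.add analyticAt_const)
    exact ha.mul (ih (right_ne_zero_of_mul hs))

namespace LFunctionData

variable (D : LFunctionData) {ρ : ℂ}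

lemma archFactor_ne_zero (hρ : ρ.re = 1 / 2) : D.archFactor ρ ≠ 0 := D.regular_on_line ρ hρ

lemma analyticAt_archFactor (hρ : ρ.re = 1 / 2) : AnalyticAt ℂ D.archFactor ρ := by
  have h := D.archFactor_ne_zero hρ
  unfold archFactor at h ⊢
  have hN : (D.cond : ℂ) ≠ 0 := by exact_mod_cast D.cond_pos.ne'
  have : Differentiable ℂ fun s : ℂ => (D.cond : ℂ) ^ (s / 2) := fun s =>
    DifferentiableAt.const_cpow (by fun_prop) (Or.inl hN)
  exact (this.analyticAt ρ).mul (analyticAt_multiset_prod_Gammaℝ (right_ne_zero_of_mul h))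

lemma analyticAt_completed (hρ : ρ.re = 1 / 2) : AnalyticAt ℂ D.completed ρ :=
  (D.analyticAt_archFactor hρ).mul (D.entire.analyticAt ρ)

lemma analyticOrderAt_completed (hρ : ρ.re = 1 / 2) :
    analyticOrderAt D.completed ρ = analyticOrderAt D.L ρ := by
  have : D.completed = D.archFactor * D.L := rfl
  rw [this, analyticOrderAt_mul (D.analyticAt_archFactor hρ) (D.entire.analyticAt ρ),
    analyticOrderAt_eq_zero.2 (Or.inr (D.archFactor_ne_zero hρ)), zero_add]

lemma zeroMult_eq (hρ : ρ.re = 1 / 2) : D.zeroMult ρ = (analyticOrderAt D.completed ρ).toNat := by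
  rw [zeroMult, (D.analyticAt_completed hρ).meromorphicOrderAt_eq]
  cases analyticOrderAt D.completed ρ <;> simp

/-- If L vanished identically, Λ would have order ⊤ > 0 at s = 0, off the line, against GRH. Thus
truncating orders to ℕ in `zeroMult` loses nothing. -/
lemma analyticOrderAt_L_ne_top (h : D.GRH) : analyticOrderAt D.L ρ ≠ ⊤ := by
  intro htop
  have h0 := (AnalyticOnNhd.analyticOrderAt_eq_top_iff_eq_zero ρ D.entire.analyticAt).1 htop
  have hc : D.completed = fun _ => 0 := by
    funext s; simp [completed, h0]
  have := h 0 (by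
    have : meromorphicOrderAt D.completed 0 = ⊤ :=
      meromorphicOrderAt_eq_top_iff.2 (Eventually.of_forall fun s => by rw [hc])
    rw [this]; exact WithTop.coe_lt_top 0)
  norm_num at this

lemma coe_zeroMult (h : D.GRH) (hρ : ρ.re = 1 / 2) :
    (D.zeroMult ρ : ℕ∞) = analyticOrderAt D.L ρ := by
  rw [D.zeroMult_eq hρ, D.analyticOrderAt_completed hρ]
  exact ENat.natCast_toNat (D.analyticOrderAt_L_ne_top h)

end LFunctionData

/-! ### Zeros at symmetric heights and positivity -/

namespace LFamily

variable {A ι : Type*} (𝓛 : LFamily A) {c : A → ℝ}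

/-- Both archimedean factors are non-zero near ρ, so the functional equation holds on a
neighbourhood, and s ↦ 1 - s preserves orders. -/
lemma zeroMult_dual (f : A) {ρ : ℂ} (hρ : ρ.re = 1 / 2) :
    (𝓛.data f).zeroMult ρ = (𝓛.data (𝓛.dual f)).zeroMult (1 - ρ) := by
  have hρ' : (1 - ρ).re = 1 / 2 := by simp [hρ]; norm_num
  rw [LFunctionData.zeroMult_eq _ hρ, LFunctionData.zeroMult_eq _ hρ']
  have hε : 𝓛.rootNumber f ≠ 0 := norm_pos_iff.1 (by rw [𝓛.norm_rootNumber]; exact one_pos)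
  have hsub : AnalyticAt ℂ (fun s : ℂ => 1 - s) ρ := by fun_prop
  have hev : (𝓛.data f).completed =ᶠ[𝓝 ρ]
      (fun _ => 𝓛.rootNumber f) * ((𝓛.data (𝓛.dual f)).completed ∘ fun s => 1 - s) := by
    have h1 := ((𝓛.data f).analyticAt_archFactor hρ).continuousAt.eventually_ne
      ((𝓛.data f).archFactor_ne_zero hρ)
    have h2 := (ContinuousAt.comp (f := fun s : ℂ => 1 - s)
      ((𝓛.data (𝓛.dual f)).analyticAt_archFactor hρ').continuousAt
      hsub.continuousAt).eventually_ne ((𝓛.data (𝓛.dual f)).archFactor_ne_zero hρ')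
    filter_upwards [h1, h2] with s hs1 hs2
    exact 𝓛.functional_equation f s hs1 hs2
  have hconst : analyticOrderAt (fun _ : ℂ => 𝓛.rootNumber f) ρ = 0 :=
    analyticOrderAt_eq_zero.2 (Or.inr hε)
  rw [analyticOrderAt_congr hev, analyticOrderAt_mul analyticAt_const
      (((𝓛.data (𝓛.dual f)).analyticAt_completed hρ').comp hsub),
    hconst, zero_add,
    analyticOrderAt_comp_of_deriv_ne_zero hsub (by simp)]

/-- The point of the critical line at normalized height `t`. -/
def criticalPoint (c : A → ℝ) (t : ℝ) (f : A) : ℂ :=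
  1 / 2 + 2 * Real.pi * Complex.I * t / Real.log (c f)

lemma criticalPoint_eq (c : A → ℝ) (t : ℝ) (f : A) : criticalPoint c t f =
    1 / 2 + ((2 * Real.pi * t / Real.log (c f) : ℝ) : ℂ) * Complex.I := by
  rw [criticalPoint]; push_cast; ring

lemma criticalPoint_re (c : A → ℝ) (t : ℝ) (f : A) : (criticalPoint c t f).re = 1 / 2 := by
  rw [criticalPoint_eq, Complex.add_re, Complex.re_ofReal_mul]; simp

lemma criticalPoint_im (c : A → ℝ) (t : ℝ) (f : A) :
    (criticalPoint c t f).im = 2 * Real.pi * t / Real.log (c f) := by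
  rw [criticalPoint_eq, Complex.add_im, Complex.im_ofReal_mul]; simp

lemma one_sub_criticalPoint (c : A → ℝ) (t : ℝ) (f : A) :
    1 - criticalPoint c t f = criticalPoint c (-t) f := by
  rw [criticalPoint, criticalPoint]; push_cast; ring

variable {𝓛}

lemma densityTerm_criticalPoint (hc : 𝓛.IsAnalyticConductor c) (φ : ℝ → ℝ) (t : ℝ) (f : A) :
    𝓛.densityTerm c φ f (criticalPoint c t f) =
      (𝓛.data f).zeroMult (criticalPoint c t f) * φ t := by
  have hlog : Real.log (c f) ≠ 0 := (Real.log_pos (hc.one_lt f)).ne'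
  rw [densityTerm, criticalPoint_im]
  congr 2
  field_simp

/-- Reindex by f ↦ f̄, which preserves `S` and c_f and exchanges the heights t and -t. -/
lemma sum_zeroMult_neg (hc : 𝓛.IsAnalyticConductor c) {S : Finset A}
    (hS : ∀ f ∈ S, 𝓛.dual f ∈ S) (t : ℝ) :
    ∑ f ∈ S, ((𝓛.data f).zeroMult (criticalPoint c (-t) f) : ℝ) =
      ∑ f ∈ S, ((𝓛.data f).zeroMult (criticalPoint c t f) : ℝ) := by
  refine Finset.sum_nbij' 𝓛.dual 𝓛.dual hS hS (fun f _ => 𝓛.dual_dual f)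
    (fun f _ => 𝓛.dual_dual f) fun f _ => ?_
  rw [𝓛.zeroMult_dual f (criticalPoint_re c _ f), one_sub_criticalPoint, neg_neg]
  simp only [criticalPoint, hc.dual_eq]

/-- All terms are non-negative, so only those at heights ±t are kept. For t ≠ 0 these are two
distinct points, whence the factor 2. -/
lemma sum_zeroMult_le (hc : 𝓛.IsAnalyticConductor c) {S : Finset A}
    (hS : ∀ f ∈ S, 𝓛.dual f ∈ S) {φ : ℝ → ℝ} (h0 : ∀ x, 0 ≤ φ x) (heven : ∀ x, φ (-x) = φ x)
    (hsum : ∀ f ∈ S, Summable fun ρ : ℂ => 𝓛.densityTerm c φ f ρ) (t : ℝ) :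
    ((if t = 0 then 1 else 2) * φ t) * ∑ f ∈ S, ((𝓛.data f).zeroMult (criticalPoint c t f) : ℝ) ≤
      ∑ f ∈ S, ∑' ρ : ℂ, 𝓛.densityTerm c φ f ρ := by
  have hnn : ∀ f ρ, 0 ≤ 𝓛.densityTerm c φ f ρ := fun f ρ =>
    mul_nonneg (Nat.cast_nonneg _) (h0 _)
  split_ifs with ht
  · rw [one_mul, Finset.mul_sum]
    refine Finset.sum_le_sum fun f hf => ?_
    rw [mul_comm, ← densityTerm_criticalPoint hc]
    exact (hsum f hf).le_tsum _ fun ρ _ => hnn f ρ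
  · have e : 2 * φ t * ∑ f ∈ S, ((𝓛.data f).zeroMult (criticalPoint c t f) : ℝ) =
        ∑ f ∈ S, (𝓛.densityTerm c φ f (criticalPoint c t f) +
          𝓛.densityTerm c φ f (criticalPoint c (-t) f)) := by
      simp only [densityTerm_criticalPoint hc, heven, Finset.sum_add_distrib, ← Finset.sum_mul,
        sum_zeroMult_neg hc hS]
      ring
    rw [e]
    refine Finset.sum_le_sum fun f hf => ?_
    have hne : criticalPoint c t f ≠ criticalPoint c (-t) f := by
      intro h
      have h1 := congrArg Complex.im h
      have hlog : Real.log (c f) ≠ 0 := (Real.log_pos (hc.one_lt f)).ne'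
      rw [criticalPoint_im, criticalPoint_im, div_left_inj' hlog] at h1
      have := mul_left_cancel₀ (by positivity : (2 * Real.pi : ℝ) ≠ 0) h1
      exact ht (by linarith)
    rw [← Finset.sum_pair hne]
    exact (hsum f hf).sum_le_tsum _ fun ρ _ => hnn f ρ

lemma avgOrder_eq {S : Finset A} (hGRH : ∀ f ∈ S, (𝓛.data f).GRH) (hS : 0 < S.card) (t : ℝ) :
    𝓛.avgOrder c t S = ENNReal.ofReal
      ((∑ f ∈ S, ((𝓛.data f).zeroMult (criticalPoint c t f) : ℝ)) / S.card) := by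
  have hS' : (0 : ℝ) < S.card := by exact_mod_cast hS
  rw [avgOrder, ENNReal.ofReal_div_of_pos hS', ENNReal.ofReal_natCast,
    ENNReal.ofReal_sum_of_nonneg fun _ _ => Nat.cast_nonneg _]
  congr 1
  refine Finset.sum_congr rfl fun f hf => ?_
  rw [ENNReal.ofReal_natCast, ← ENat.toENNReal_coe,
    (𝓛.data f).coe_zeroMult (hGRH f hf) (criticalPoint_re c t f)]
  congr 1
  have := analyticOrderAt_comp_of_deriv_ne_zero (f := (𝓛.data f).L)
    (g := fun s : ℂ => s + 2 * Real.pi * Complex.I * t / Real.log (c f)) (z₀ := 1 / 2)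
    (by fun_prop) (by simp)
  exact this

theorem limsup_avgOrder_le (hc : 𝓛.IsAnalyticConductor c) {l : Filter ι} {F : ι → Finset A}
    (hcard : Tendsto (fun i => (F i).card) l atTop) (hdual : ∀ i, ∀ f ∈ F i, 𝓛.dual f ∈ F i)
    (hGRH : ∀ i, ∀ f ∈ F i, (𝓛.data f).GRH) {G : SymmetryGroup} {φ : ℝ → ℝ} (h0 : ∀ x, 0 ≤ φ x)
    (heven : ∀ x, φ (-x) = φ x) (hd : 𝓛.OneLevelDensity c l F G φ) {t : ℝ} (ht : 0 < φ t) :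
    limsup (fun i => 𝓛.avgOrder c t (F i)) l ≤
      ENNReal.ofReal ((∫ x, φ x ∂G.W) / ((if t = 0 then 1 else 2) * φ t)) := by
  rcases l.eq_or_neBot with rfl | hl
  · simp
  set m : ℝ := (if t = 0 then 1 else 2) * φ t with hm
  have hm0 : 0 < m := by rw [hm]; split_ifs <;> linarith
  have htend := ENNReal.tendsto_ofReal (hd.2.div_const m)
  rw [← htend.limsup_eq]
  refine limsup_le_limsup ?_
  filter_upwards [hcard.eventually_gt_atTop 0] with i hi
  rw [avgOrder_eq (hGRH i) hi]
  refine ENNReal.ofReal_le_ofReal ?_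
  have := sum_zeroMult_le hc (hdual i) h0 heven (hd.1 i) t
  rw [div_right_comm]
  gcongr
  rw [le_div_iff₀' hm0]
  exact this

end LFamily

/-! ### Removing the dilation, and positivity of the kernel on the diagonal -/

lemma tendsto_integral_W_comp_mul {G : SymmetryGroup} {g : ℝ → ℝ} (hg : Continuous g)
    (hi : Integrable g) :
    Tendsto (fun r : ℝ => ∫ x, g (r * x) ∂G.W) (𝓝[<] 1) (𝓝 (∫ x, g x ∂G.W)) := by
  have hpos : ∀ᶠ r : ℝ in 𝓝[<] 1, 0 < r :=
    (eventually_gt_nhds one_pos).filter_mono nhdsWithin_le_nhds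
  have hGc := G.continuous_density
  -- The substitution x ↦ x/r moves the dilation onto the bounded density, so 2|g| dominates; g(rx)
  -- itself has no evident integrable majorant. The atom is unaffected by dilation.
  have hlim : Tendsto (fun r : ℝ => |r⁻¹| • (∫ x, G.density (r⁻¹ * x) * g x) + G.atom * g 0) (𝓝[<] 1)
      (𝓝 (|(1:ℝ)⁻¹| • (∫ x, G.density x * g x) + G.atom * g 0)) := by
    refine (Tendsto.smul ?_ ?_).add_const _
    · exact ((continuousAt_inv₀ one_ne_zero).abs).tendsto.mono_left nhdsWithin_le_nhds
    · refine tendsto_integral_filter_of_dominated_convergence (fun x => 2 * ‖g x‖)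
        (Eventually.of_forall fun r => Continuous.aestronglyMeasurable (by fun_prop))
        (Eventually.of_forall fun r => Eventually.of_forall fun x => ?_) (hi.norm.const_mul 2)
        (Eventually.of_forall fun x => ?_)
      · rw [norm_mul, Real.norm_eq_abs, abs_of_nonneg (G.density_nonneg _)]
        gcongr
        exact G.density_le_two _
      · have h1 : ContinuousAt (fun r : ℝ => G.density (r⁻¹ * x) * g x) 1 := by
          have : ContinuousAt (fun r : ℝ => r⁻¹ * x) 1 :=
            (continuousAt_inv₀ one_ne_zero).mul continuousAt_const
          exact (hGc.continuousAt.comp this).mul continuousAt_const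
        have := h1.tendsto.mono_left (nhdsWithin_le_nhds (s := Iio 1))
        simpa using this
  have hW : ∫ x, g x ∂G.W = |(1:ℝ)⁻¹| • (∫ x, G.density x * g x) + G.atom * g 0 := by
    rw [SymmetryGroup.integral_W (SymmetryGroup.integrable_W_of_volume hg hi)]
    simp
  rw [hW]
  refine hlim.congr' ?_
  filter_upwards [hpos] with r hr
  have hir : Integrable fun x => g (r * x) := hi.comp_mul_left' hr.ne'
  rw [SymmetryGroup.integral_W (SymmetryGroup.integrable_W_of_volume (by fun_prop) hir)]
  have := Measure.integral_comp_mul_left (fun x => G.density (r⁻¹ * x) * g x) r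
  rw [← this]
  simp [inv_mul_cancel_left₀ hr.ne']

lemma coe_integral_sq (G : SymmetryGroup) (F : ℂ → ℂ) :
    ((∫ x : ℝ, ‖F x‖ ^ 2 ∂G.W : ℝ) : ℂ) = ∫ x : ℝ, F x * conj (F x) ∂G.W := by
  rw [← integral_complex_ofReal]
  refine integral_congr_ae (Eventually.of_forall fun x => ?_)
  simp [Complex.mul_conj, Complex.normSq_eq_norm_sq]

lemma exists_mem_modelSpace_eq_one (G : SymmetryGroup) {Δ : ℝ} (hΔ : 0 < Δ) (t : ℝ) :
    ∃ F ∈ modelSpace G Δ, F t = 1 := by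
  obtain ⟨H, h, hHd, hHb, hHh, -, h0⟩ := exists_entire_schwartz
  have ha : 0 < Δ / 2 := by positivity
  -- `H` has type 2π, so scaling by Δ/2 gives πΔ.
  refine ⟨fun z => H ((Δ / 2 : ℝ) * (z - t)), (mem_modelSpace_iff hΔ).2 ⟨by fun_prop,
    hasExpType_of_norm_le_exp_im (C := 1) (by positivity) fun z => (hHb _).trans_eq ?_, ?_⟩, ?_⟩
  · rw [Complex.im_ofReal_mul, abs_mul, abs_of_pos ha]
    simp only [Complex.sub_im, Complex.ofReal_im, sub_zero, one_mul]
    ring_nf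
  · have hi : Integrable fun x : ℝ => h (Δ / 2 * (x - t)) :=
      (h.integrable.comp_mul_left' ha.ne').comp_sub_right t
    have hc := h.continuous
    refine hi.norm.mono' (Continuous.aestronglyMeasurable (by
      have := hHd.continuous; fun_prop)) (Eventually.of_forall fun x => ?_)
    have e : ((Δ / 2 : ℝ) : ℂ) * (x - t) = ((Δ / 2 * (x - t) : ℝ) : ℂ) := by push_cast; ring
    have h1 := hHb ((Δ / 2 * (x - t) : ℝ) : ℂ)
    rw [e]
    simp only [Complex.ofReal_im, abs_zero, mul_zero, Real.exp_zero, hHh, Complex.norm_real] at h1 ⊢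
    rw [norm_pow, norm_norm, sq]
    exact mul_le_of_le_one_left (norm_nonneg _) h1
  · have := hHh 0
    simp only [sub_self, mul_zero]
    simpa [h0] using this

namespace IsReproducingKernel

variable {G : SymmetryGroup} {Δ : ℝ} {K : ℂ → ℂ → ℂ}

lemma diag_eq (hK : IsReproducingKernel G Δ K) (w : ℂ) :
    K w w = ((∫ x : ℝ, ‖K w x‖ ^ 2 ∂G.W : ℝ) : ℂ) := by
  rw [coe_integral_sq]; exact (hK w).2 _ (hK w).1

lemma coe_re_diag (hK : IsReproducingKernel G Δ K) (w : ℂ) : (((K w w).re : ℝ) : ℂ) = K w w := by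
  rw [hK.diag_eq w, Complex.ofReal_re]

/-- K(t,t) is the squared norm of K(t,·). Were it 0, every element of the space would vanish at t.
-/
lemma re_diag_pos (hΔ : 0 < Δ) (hK : IsReproducingKernel G Δ K) (t : ℝ) : 0 < (K t t).re := by
  have h0 : 0 ≤ (K t t).re := by
    rw [hK.diag_eq, Complex.ofReal_re]
    exact integral_nonneg fun x => by positivity
  refine h0.lt_of_ne fun h => ?_
  obtain ⟨F, hF, hFt⟩ := exists_mem_modelSpace_eq_one G hΔ t
  have hz : K t = 0 := modelSpace_eq_zero_of_integral_mul_conj hΔ (hK t).1 (by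
    rw [← (hK t).2 _ (hK t).1, ← hK.coe_re_diag, ← h, Complex.ofReal_zero])
  have := (hK t).2 F hF
  rw [hFt, hz] at this
  simp at this

/-- Hermitian symmetry sends K(w,-w) to K(-w,w), and reflection sends it back. -/
lemma coe_re_antidiag (hΔ : 0 < Δ) (hK : IsReproducingKernel G Δ K) (w : ℂ) :
    (((K w (-w)).re : ℝ) : ℂ) = K w (-w) := by
  refine Complex.conj_eq_iff_re.1 ?_
  rw [hK.conj_symm]
  simpa using hK.neg_neg hΔ w (-w)

end IsReproducingKernel

/-! ### The bound from an arbitrary element of the model space -/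

namespace LFamily

variable {A ι : Type*} {𝓛 : LFamily A} {c : A → ℝ}

theorem limsup_avgOrder_le_of_mem_modelSpace (hc : 𝓛.IsAnalyticConductor c) {l : Filter ι}
    {F : ι → Finset A} (hcard : Tendsto (fun i => (F i).card) l atTop)
    (hdual : ∀ i, ∀ f ∈ F i, 𝓛.dual f ∈ F i) (hGRH : ∀ i, ∀ f ∈ F i, (𝓛.data f).GRH)
    {G : SymmetryGroup} {Δ : ℝ} (hΔ : 0 < Δ)
    (hdensity : ∀ φ : 𝓢(ℝ, ℝ), (∀ x, φ (-x) = φ x) →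
      tsupport (𝓕 (fun x : ℝ => (φ x : ℂ))) ⊆ Ioo (-Δ) Δ → 𝓛.OneLevelDensity c l F G φ)
    {Φ : ℂ → ℂ} (hΦ : Φ ∈ modelSpace G Δ) (heven : ∀ x : ℝ, ‖Φ (-x)‖ = ‖Φ x‖) {t : ℝ}
    (ht : Φ t ≠ 0) :
    limsup (fun i => 𝓛.avgOrder c t (F i)) l ≤
      ENNReal.ofReal ((∫ x : ℝ, ‖Φ x‖ ^ 2 ∂G.W) / ((if t = 0 then 1 else 2) * ‖Φ t‖ ^ 2)) := by
  obtain ⟨H, h, hHd, hHb, hHh, hh, h0⟩ := exists_entire_schwartz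
  have hh1 : ∀ x, |h x| ≤ 1 := fun x => by
    have := hHb x
    simpa [hHh] using this
  have hΦc := hΦ.1.continuous
  have hhc := h.continuous
  set ψ : ℝ → ℝ := fun r => ‖Φ (r * t)‖ ^ 2 * h (Δ * (1 - r) / 4 * t) ^ 2 with hψ
  have hψlim : Tendsto ψ (𝓝[<] 1) (𝓝 (‖Φ t‖ ^ 2)) := by
    have : Tendsto ψ (𝓝[<] 1) (𝓝 (ψ 1)) :=
      (Continuous.tendsto (by fun_prop) 1).mono_left nhdsWithin_le_nhds
    simpa [hψ, h0] using this
  have hsq : 0 < ‖Φ t‖ ^ 2 := by positivity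
  have hm : (0:ℝ) < if t = 0 then 1 else 2 := by split_ifs <;> norm_num
  have hint := tendsto_integral_W_comp_mul (G := G) (g := fun x : ℝ => ‖Φ x‖ ^ 2) (by fun_prop)
    ((mem_modelSpace_iff hΔ).1 hΦ).2.2
  have hlim := ENNReal.tendsto_ofReal (hint.div (hψlim.const_mul (if t = 0 then 1 else 2))
    (mul_pos hm hsq).ne')
  refine ge_of_tendsto hlim ?_
  filter_upwards [hψlim.eventually_const_lt hsq, self_mem_nhdsWithin,
    (eventually_gt_nhds one_pos).filter_mono nhdsWithin_le_nhds] with r hr1 hr2 hr3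
  obtain ⟨φ, hφ, hφe, hφs⟩ := exists_testFunction hΔ hΦ heven hHd hHb hHh hh hr3 hr2
  have hφt : φ t = ψ r := hφ t
  refine (limsup_avgOrder_le hc hcard hdual hGRH (fun x => by rw [hφ]; positivity) hφe
    (hdensity φ hφe hφs) (t := t) (by rw [hφt]; exact hr1)).trans ?_
  rw [hφt]
  -- Since h² ≤ 1, the cut-off only lowers the integral, while its effect on the value at t
  -- disappears as r → 1.
  refine ENNReal.ofReal_le_ofReal (div_le_div_of_nonneg_right ?_ (by positivity))
  refine integral_mono_of_nonneg (Eventually.of_forall fun x => by simp only [hφ]; positivity)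
    (SymmetryGroup.integrable_W_of_volume (by fun_prop)
      (((mem_modelSpace_iff hΔ).1 hΦ).2.2.comp_mul_left' hr3.ne')) (Eventually.of_forall fun x => ?_)
  simp only [hφ]
  push_cast
  refine mul_le_of_le_one_right (by positivity) ?_
  rw [sq_le_one_iff_abs_le_one]
  exact hh1 _

end LFamily

end

/-! ### The choice of Φ -/

theorem theorem2 {A ι : Type*} (𝓛 : LFamily A) (c : A → ℝ) (hc : 𝓛.IsAnalyticConductor c)
    (l : Filter ι) (F : ι → Finset A)
    (hcard : Tendsto (fun i => (F i).card) l atTop)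
    (hdual : ∀ i, ∀ f ∈ F i, 𝓛.dual f ∈ F i)
    (hGRH : ∀ i, ∀ f ∈ F i, (𝓛.data f).GRH)
    (G : SymmetryGroup) (Δ : ℝ) (hΔ : 0 < Δ)
    (hdensity : ∀ φ : 𝓢(ℝ, ℝ), (∀ x, φ (-x) = φ x) →
      tsupport (𝓕 (fun x : ℝ => (φ x : ℂ))) ⊆ Ioo (-Δ) Δ →
      𝓛.OneLevelDensity c l F G φ) :
    (IsReproducingKernel G Δ (reproducingKernel G Δ) ∧
      ∀ K, IsReproducingKernel G Δ K → K = reproducingKernel G Δ) ∧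
    limsup (fun i => 𝓛.avgOrder c 0 (F i)) l ≤
      ENNReal.ofReal (1 / (reproducingKernel G Δ 0 0).re) ∧
    ∀ t : ℝ, 0 < t →
      limsup (fun i => 𝓛.avgOrder c t (F i)) l ≤
        ENNReal.ofReal (1 / ((reproducingKernel G Δ t t).re + ‖reproducingKernel G Δ t (-t)‖)) := by
  have hK : IsReproducingKernel G Δ (reproducingKernel G Δ) := by
    rw [reproducingKernel, dif_pos (exists_isReproducingKernel G hΔ)]
    exact (exists_isReproducingKernel G hΔ).choose_spec
  refine ⟨⟨hK, fun K h => h.unique hΔ hK⟩, ?_, fun t ht => ?_⟩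
  · set K := reproducingKernel G Δ
    have hpos := hK.re_diag_pos hΔ 0
    rw [Complex.ofReal_zero] at hpos
    have hne : K 0 0 ≠ 0 := fun h => by simp [h] at hpos
    have hint : ∫ x : ℝ, ‖K 0 x‖ ^ 2 ∂G.W = (K 0 0).re := by
      rw [hK.diag_eq 0, Complex.ofReal_re]
    have hnorm : ‖K 0 0‖ = (K 0 0).re := by
      rw [← hK.coe_re_diag, Complex.norm_real, Real.norm_of_nonneg hpos.le, Complex.ofReal_re]
    refine (LFamily.limsup_avgOrder_le_of_mem_modelSpace hc hcard hdual hGRH hΔ hdensity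
      (hK 0).1 (fun x => ?_) (t := 0) (by simpa using hne)).trans_eq ?_
    · have := hK.neg_neg hΔ 0 x
      rw [neg_zero] at this
      rw [this]
    · rw [hint, Complex.ofReal_zero, hnorm, if_pos rfl]
      congr 1
      field_simp
  · set K := reproducingKernel G Δ
    have hpos := hK.re_diag_pos hΔ t
    set a := (K t (-t)).re with ha
    have haK : K t (-t) = (a : ℂ) := (hK.coe_re_antidiag hΔ t).symm
    have haK' : K (-t) t = (a : ℂ) := by
      rw [← haK]; simpa using hK.neg_neg hΔ t (-t)
    -- `s` is the sign of K(t,-t), with s = ±1 also when it is 0. It makes `Φ` even or odd, so |Φ|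
    -- is even, and turns sK(-t,t) into |K(t,-t)|.
    obtain ⟨s, hs, hsa⟩ : ∃ s : ℝ, s * s = 1 ∧ s * a = |a| := by
      rcases le_total 0 a with h | h
      · exact ⟨1, by norm_num, by rw [abs_of_nonneg h, one_mul]⟩
      · exact ⟨-1, by norm_num, by rw [abs_of_nonpos h]; ring⟩
    set M := (K t t).re + |a| with hM
    have hMpos : 0 < M := by positivity
    set Φ : ℂ → ℂ := fun z => K t z + s * K (-t) z with hΦ
    have hΦmem : Φ ∈ modelSpace G Δ :=
      modelSpace_add hΔ (hK t).1 (modelSpace_const_mul hΔ (hK (-t)).1 s)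
    have hs' : (s : ℂ) * s = 1 := by exact_mod_cast hs
    have hrefl : ∀ z, Φ (-z) = s * Φ z := by
      intro z
      have h1 : K t (-z) = K (-t) z := by simpa using hK.neg_neg hΔ (-t) z
      simp only [hΦ, h1, hK.neg_neg hΔ t z]
      linear_combination (-(K (-t) z)) * hs'
    have hsn : ‖(s : ℂ)‖ = 1 := by
      have : ‖(s : ℂ)‖ * ‖(s : ℂ)‖ = 1 := by rw [← norm_mul, hs', norm_one]
      nlinarith [norm_nonneg (s : ℂ)]
    have hΦt : Φ t = (M : ℂ) := by
      simp only [hΦ, haK', hM, ← hsa]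
      push_cast
      rw [hK.coe_re_diag]
    -- The reproducing property gives ⟨Φ, Φ⟩ = Φ(t) + sΦ(-t) = M + s²M.
    have hint : ∫ x : ℝ, ‖Φ x‖ ^ 2 ∂G.W = 2 * M := by
      have : ((∫ x : ℝ, ‖Φ x‖ ^ 2 ∂G.W : ℝ) : ℂ) = ((2 * M : ℝ) : ℂ) := by
        rw [coe_integral_sq]
        have e : ∀ x : ℝ, Φ x * conj (Φ x) =
            Φ x * conj (K t x) + s * (Φ x * conj (K (-t) x)) := fun x => by
          simp only [hΦ, map_add, map_mul, Complex.conj_ofReal]; ring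
        simp only [e]
        rw [integral_add (modelSpace_integrable_mul_conj hΦmem (hK t).1)
          ((modelSpace_integrable_mul_conj hΦmem (hK (-t)).1).const_mul _), integral_const_mul,
          ← (hK t).2 _ hΦmem, ← (hK (-t)).2 _ hΦmem, hrefl, hΦt, ← mul_assoc, hs']
        push_cast; ring
      exact_mod_cast this
    have hnorm : ‖K t (-t)‖ = |a| := by rw [haK, Complex.norm_real, Real.norm_eq_abs]
    refine (LFamily.limsup_avgOrder_le_of_mem_modelSpace hc hcard hdual hGRH hΔ hdensity
      hΦmem (fun x => by rw [hrefl, norm_mul, hsn, one_mul]) (t := t)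
      (by rw [hΦt]; exact_mod_cast hMpos.ne')).trans_eq ?_
    rw [hint, hΦt, hnorm, if_neg ht.ne', Complex.norm_real, Real.norm_of_nonneg hMpos.le]
    congr 1
    field_simp
    exact hM.symm
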